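/- Let $G=\widetilde{SL}_2$ be the universal covering group of $SL(2)=SL(2,\mathbb R)\cong SU(1,1)$. Its Lie algebra is identified with $\mathfrak{su}(1,1)$, and $e_1,e_2,e_3$ denotes the basis $$e_1=\tfrac12\begin{pmatrix}0&1\\1&0\end{pmatrix},\quad e_2=\tfrac12\begin{pmatrix}0&i\\-i&0\end{pmatrix},\quad e_3=\tfrac12\begin{pmatrix}i/2&0\\0&-i/2\end{pmatrix}.$$ Endow $G$ with the left invariant Riemannian metric $\langle\cdot,\cdot\rangle$ for which $e_1,e_2,e_3$ are orthonormal, with its Levi-Civita connection $\nabla$, and with the orientation for which $(e_1,e_2,e_3)$ is positive. Let $f:M\to G$ be a smooth immersion of a smooth surface $M$, let $N$ be a smooth unit normal field along $f$, and suppose that the mean curvature of $f$ with respect to $N$ (half of the trace of the second fundamental form $\langle\nabla_u\, df(v),N\rangle$ with respect to the induced metric) is equal to a constant $H\in\mathbb R$. For a local conformal parameter $z=x+iy$ on $M$ which is positive, i.e. such that $(f_x,f_y,N)$ is a positively oriented frame, put $\partial=\partial_z=\frac12(\partial_x-i\partial_y)$, expand $f^{-1}\partial f=\sum_{k=1}^3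 Z_k e_k$, where $f^{-1}$ denotes the left translation to the unit of $G$ (extended complex linearly), and let $A=\langle\nabla_{f_z}f_z,N\rangle$ be the coefficient of the Hopf differential ($\langle\cdot,\cdot\rangle$ and $\nabla$ being extended complex bilinearly). Then $$\widetilde A\,dz^2=\Bigl(A+\frac{5\,Z_3^2}{2(H-i)}\Bigr)dz^2$$ is a holomorphic quadratic differential on $M$: any two positive conformal parameters $z,w$ are related by a holomorphic change of parameter on their common domain, with $\widetilde A_z=\widetilde A_w\,(dw/dz)^2$ there, and in each positive conformal parameter $z$ the coefficient $\widetilde A$ is a holomorphic function of $z$. -/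

import Mathlib

open scoped Manifold ContDiff Matrix ComplexConjugate
open Complex (I)

noncomputable section

/-- The universal covering group of `SL(2)`. In the disc model `SL(2)` is realized as the group
`SU(1,1)` of the matrices with rows `(a, b)` and `(conj b, conj a)`, where `|a|² - |b|² = 1`. Such a
matrix is given by `b : ℂ` and the argument `t` of `a = √(1 + |b|²) exp (i t)`; on the universal
covering `t` is a real number, so that `(t, b) : ℝ × ℂ` is a global chart. -/
def SLTilde : Type := ℝ × ℂ

namespace SLTilde

instance : TopologicalSpace SLTilde := inferInstanceAs (TopologicalSpace (ℝ × ℂ))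
instance : ChartedSpace (ℝ × ℂ) SLTilde := inferInstanceAs (ChartedSpace (ℝ × ℂ) (ℝ × ℂ))
instance : IsManifold 𝓘(ℝ, ℝ × ℂ) ∞ SLTilde :=
  inferInstanceAs (IsManifold 𝓘(ℝ, ℝ × ℂ) ∞ (ℝ × ℂ))
instance : ContractibleSpace SLTilde := inferInstanceAs (ContractibleSpace (ℝ × ℂ))

/-- The entry `a` of the matrix below `g = (t, b)`. -/
def a (g : SLTilde) : ℂ := (√(1 + Complex.normSq g.2) : ℝ) * Complex.exp (g.1 * I)

/-- The entry `b` of the matrix below `g = (t, b)`. -/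
def b (g : SLTilde) : ℂ := g.2

lemma normSq_a (g : SLTilde) : Complex.normSq g.a = 1 + Complex.normSq g.b := by
  have h : 0 ≤ 1 + Complex.normSq g.2 := by have := Complex.normSq_nonneg g.2; linarith
  have h2 : Complex.normSq (Complex.exp (g.1 * I)) = 1 := by
    rw [Complex.normSq_eq_norm_sq, Complex.norm_exp_ofReal_mul_I]; norm_num
  simp only [a, b, Complex.normSq_mul, h2, Complex.normSq_ofReal, Real.mul_self_sqrt h, mul_one]

lemma a_ne_zero (g : SLTilde) : g.a ≠ 0 := by
  intro h
  have := normSq_a g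
  rw [h, Complex.normSq_zero] at this
  linarith [Complex.normSq_nonneg g.b]

/-- The product of the matrices below `g` and `h` has the upper left entry
`a(g) a(h) + b(g) conj (b(h)) = a(g) a(h) * corr g h`, and `corr g h` has positive real part. -/
def corr (g h : SLTilde) : ℂ := 1 + g.b * conj h.b / (g.a * h.a)

/-- The lift of the matrix product: the arguments of `a(g)`, `a(h)` and `corr g h` (the last one
in `(-π/2, π/2)`) add up. -/
instance : Mul SLTilde where
  mul g h := (g.1 + h.1 + (corr g h).arg, g.a * h.b + g.b * conj h.a)

instance : One SLTilde where
  one := ((0 : ℝ), (0 : ℂ))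

instance : Inv SLTilde where
  inv g := (-g.1, -g.2)

lemma mul_fst (g h : SLTilde) : (g * h).1 = g.1 + h.1 + (corr g h).arg := rfl
lemma b_mul (g h : SLTilde) : (g * h).b = g.a * h.b + g.b * conj h.a := rfl
lemma b_one : (1 : SLTilde).b = 0 := rfl
lemma b_inv (g : SLTilde) : (g⁻¹).b = -g.b := rfl
lemma a_one : (1 : SLTilde).a = 1 := by
  have h1 : (1 : SLTilde).1 = 0 := rfl
  have h2 : (1 : SLTilde).2 = 0 := rfl
  simp [a, h1, h2]
lemma a_inv (g : SLTilde) : (g⁻¹).a = conj g.a := by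
  have h1 : (g⁻¹).1 = -g.1 := rfl
  have h2 : (g⁻¹).2 = -g.2 := rfl
  simp only [a, h1, h2, Complex.normSq_neg, map_mul, Complex.conj_ofReal, ← Complex.exp_conj,
    Complex.conj_I]
  push_cast; ring_nf

lemma corr_re_pos (g h : SLTilde) : 0 < (corr g h).re := by
  have hn : ‖g.b * conj h.b / (g.a * h.a)‖ < 1 := by
    have key : ∀ k : SLTilde, ‖k.b‖ < ‖k.a‖ := fun k ↦ by
      have := normSq_a k
      rw [Complex.normSq_eq_norm_sq, Complex.normSq_eq_norm_sq] at this
      nlinarith [norm_nonneg k.a, norm_nonneg k.b]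
    have hg := key g
    have hh := key h
    have h1 := (norm_nonneg g.b).trans_lt hg
    have h2 := (norm_nonneg h.b).trans_lt hh
    rw [norm_div, norm_mul, norm_mul, RCLike.norm_conj, div_lt_one (mul_pos h1 h2)]
    exact mul_lt_mul'' hg hh (norm_nonneg _) (norm_nonneg _)
  have := (abs_lt.1 ((Complex.abs_re_le_norm _).trans_lt hn)).1
  simp only [corr, Complex.add_re, Complex.one_re]
  linarith

lemma abs_arg_corr_lt (g h : SLTilde) : |(corr g h).arg| < Real.pi / 2 :=
  Complex.abs_arg_lt_pi_div_two_iff.2 (Or.inl (corr_re_pos g h))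

lemma a_mul (g h : SLTilde) : (g * h).a = g.a * h.a + g.b * conj h.b := by
  have hw : g.a * h.a + g.b * conj h.b = g.a * h.a * corr g h := by
    have := a_ne_zero g
    have := a_ne_zero h
    unfold corr
    field_simp
  have hn : 1 + Complex.normSq (g * h).b = Complex.normSq (g.a * h.a + g.b * conj h.b) := by
    have h1 := normSq_a g
    have h2 := normSq_a h
    rw [b_mul]
    simp only [Complex.normSq_apply, Complex.add_re, Complex.add_im, Complex.mul_re,
      Complex.mul_im, Complex.conj_re, Complex.conj_im] at h1 h2 ⊢
    linear_combination (-(h.a.re * h.a.re + h.a.im * h.a.im) +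
      (h.b.re * h.b.re + h.b.im * h.b.im)) * h1 - h2
  have e : (g * h).a = (√(1 + Complex.normSq (g * h).b) : ℝ) *
      Complex.exp ((g.1 + h.1 + (corr g h).arg : ℝ) * I) := rfl
  have hc := Complex.norm_mul_exp_arg_mul_I (corr g h)
  rw [e, hn, hw, Complex.normSq_eq_norm_sq, Real.sqrt_sq (norm_nonneg _), norm_mul, norm_mul]
  have ha : ∀ k : SLTilde, (‖k.a‖ : ℂ) * Complex.exp (k.1 * I) = k.a := fun k ↦ by
    have : ‖k.a‖ = √(1 + Complex.normSq k.2) := by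
      rw [← Real.sqrt_sq (norm_nonneg k.a), ← Complex.normSq_eq_norm_sq, normSq_a]; rfl
    rw [this]; rfl
  calc _ = (‖g.a‖ * Complex.exp (g.1 * I)) * (‖h.a‖ * Complex.exp (h.1 * I)) *
        (‖corr g h‖ * Complex.exp ((corr g h).arg * I)) := by
          push_cast; rw [add_mul, add_mul, Complex.exp_add, Complex.exp_add]; ring
    _ = _ := by rw [hc, ha, ha]

lemma ext_of_abs_lt {g h : SLTilde} (ha : g.a = h.a) (hb : g.b = h.b)
    (ht : |g.1 - h.1| < 2 * Real.pi) : g = h := by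
  have hb' : g.2 = h.2 := hb
  have hs : ((√(1 + Complex.normSq h.2) : ℝ) : ℂ) ≠ 0 := fun h0 ↦ a_ne_zero h (by simp [a, h0])
  have he : Complex.exp (g.1 * I) = Complex.exp (h.1 * I) := by
    simp only [a, hb'] at ha
    exact mul_left_cancel₀ hs ha
  obtain ⟨n, hn⟩ := Complex.exp_eq_exp_iff_exists_int.1 he
  have hn' : g.1 - h.1 = n * (2 * Real.pi) := by
    have := congrArg Complex.im hn
    simp at this
    linarith
  have h0 : n = 0 := by
    rw [hn', abs_mul, abs_of_pos Real.two_pi_pos] at ht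
    have : |(n : ℝ)| < 1 := by
      by_contra! hc
      nlinarith [Real.two_pi_pos]
    rw [← Int.cast_abs] at this
    have h2 : |n| < 1 := by exact_mod_cast this
    exact Int.abs_lt_one_iff.1 h2
  refine Prod.ext ?_ hb'
  rw [h0] at hn'
  simpa [sub_eq_zero] using hn'

instance : Group SLTilde where
  mul_assoc g h k := by
    refine ext_of_abs_lt ?_ ?_ ?_
    · simp only [a_mul, b_mul, map_add, map_mul, Complex.conj_conj]; ring
    · simp only [a_mul, b_mul, map_add, map_mul, Complex.conj_conj]; ring
    · have h1 := abs_lt.1 (abs_arg_corr_lt (g * h) k)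
      have h2 := abs_lt.1 (abs_arg_corr_lt g h)
      have h3 := abs_lt.1 (abs_arg_corr_lt g (h * k))
      have h4 := abs_lt.1 (abs_arg_corr_lt h k)
      simp only [mul_fst]
      rw [abs_lt]
      constructor <;> linarith
  one_mul g := by
    refine Prod.ext ?_ ?_
    · rw [mul_fst]; simp [corr, b_one]; rfl
    · change (1 * g).b = g.b; simp [b_mul, b_one, a_one]
  mul_one g := by
    refine Prod.ext ?_ ?_
    · rw [mul_fst]; simp [corr, b_one]; rfl
    · change (g * 1).b = g.b; simp [b_mul, b_one, a_one]
  inv_mul_cancel g := by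
    refine ext_of_abs_lt ?_ ?_ ?_
    · rw [a_mul, a_one, a_inv, b_inv, neg_mul, Complex.mul_conj, ← Complex.normSq_eq_conj_mul_self,
        normSq_a]
      push_cast; ring
    · rw [b_mul, a_inv, b_inv, b_one]; ring
    · have h1 := abs_lt.1 (abs_arg_corr_lt g⁻¹ g)
      have h2 : (g⁻¹).1 = -g.1 := rfl
      have h3 : (1 : SLTilde).1 = 0 := rfl
      rw [mul_fst, h2, h3, abs_lt]
      constructor <;> linarith [Real.pi_pos]

lemma contDiff_a : ContDiff ℝ ∞ (fun g : ℝ × ℂ ↦ a g) := by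
  have h1 : ContDiff ℝ ∞ (fun g : ℝ × ℂ ↦ √(1 + ‖g.2‖ ^ 2)) :=
    (contDiff_const.add (contDiff_snd.norm_sq ℝ)).sqrt fun g ↦ by positivity
  have h2 : ContDiff ℝ ∞ (fun g : ℝ × ℂ ↦ Complex.exp (g.1 * I)) :=
    ((Complex.ofRealCLM.contDiff.comp contDiff_fst).mul contDiff_const).cexp
  have h3 := (Complex.ofRealCLM.contDiff.comp h1).mul h2
  have h4 : (fun g : ℝ × ℂ ↦ a g) = fun g : ℝ × ℂ ↦
      (√(1 + ‖g.2‖ ^ 2) : ℝ) * Complex.exp (g.1 * I) := by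
    funext g
    simp only [a, Complex.normSq_eq_norm_sq]
  rw [h4]
  exact h3

lemma contDiff_mul_aux : ContDiff ℝ ∞ (fun p : (ℝ × ℂ) × (ℝ × ℂ) ↦
    ((p.1.1 + p.2.1 + (corr p.1 p.2).arg, a p.1 * b p.2 + b p.1 * conj (a p.2)) : ℝ × ℂ)) := by
  have a1 : ContDiff ℝ ∞ (fun p : (ℝ × ℂ) × (ℝ × ℂ) ↦ a p.1) := contDiff_a.comp contDiff_fst
  have a2 : ContDiff ℝ ∞ (fun p : (ℝ × ℂ) × (ℝ × ℂ) ↦ a p.2) := contDiff_a.comp contDiff_snd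
  have b1 : ContDiff ℝ ∞ (fun p : (ℝ × ℂ) × (ℝ × ℂ) ↦ b p.1) :=
    contDiff_snd.comp contDiff_fst
  have b2 : ContDiff ℝ ∞ (fun p : (ℝ × ℂ) × (ℝ × ℂ) ↦ b p.2) :=
    contDiff_snd.comp contDiff_snd
  have hc : ContDiff ℝ ∞ (fun p : (ℝ × ℂ) × (ℝ × ℂ) ↦ corr p.1 p.2) := by
    unfold corr
    simp only [div_eq_mul_inv]
    exact contDiff_const.add ((b1.mul (Complex.conjCLE.contDiff.comp b2)).mul
      ((a1.mul a2).inv fun p ↦ mul_ne_zero (a_ne_zero p.1) (a_ne_zero p.2)))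
  have hl : ContDiff ℝ ∞ (fun p : (ℝ × ℂ) × (ℝ × ℂ) ↦ (corr p.1 p.2).arg) := by
    rw [contDiff_iff_contDiffAt]
    intro p
    have h1 : ContDiffAt ℝ ∞ Complex.log (corr p.1 p.2) :=
      (Complex.contDiffAt_log (Or.inl (corr_re_pos p.1 p.2))).restrict_scalars ℝ
    have h2 := Complex.imCLM.contDiff.contDiffAt.comp p (h1.comp p hc.contDiffAt)
    refine h2.congr_of_eventuallyEq (Filter.Eventually.of_forall fun q ↦ ?_)
    simp [Complex.log_im]
  exact ((((contDiff_fst.comp contDiff_fst).add (contDiff_fst.comp contDiff_snd)).add hl)).prodMk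
    ((a1.mul b2).add (b1.mul (Complex.conjCLE.contDiff.comp a2)))

/-- The universal covering group is a smooth Lie group. -/
instance : LieGroup 𝓘(ℝ, ℝ × ℂ) ∞ SLTilde where
  contMDiff_mul := by
    have := contDiff_mul_aux
    rw [← contMDiff_iff_contDiff, modelWithCornersSelf_prod, ← chartedSpaceSelf_prod] at this
    exact this
  contMDiff_inv := by
    have : ContDiff ℝ ∞ (fun p : ℝ × ℂ ↦ -p) := contDiff_neg
    exact this.contMDiff

/-- The real unimodular matrix below `g`, obtained from the matrix in `SU(1,1)` by the isomorphism
`SU(1,1) ≃ SL(2, ℝ)` (a Cayley transform). -/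
def realMatrix (g : SLTilde) : Matrix (Fin 2) (Fin 2) ℝ :=
  !![g.a.re + g.b.re, g.b.im - g.a.im; g.b.im + g.a.im, g.a.re - g.b.re]

lemma det_realMatrix (g : SLTilde) : g.realMatrix.det = 1 := by
  have := normSq_a g
  rw [Complex.normSq_apply, Complex.normSq_apply] at this
  rw [realMatrix, Matrix.det_fin_two_of]
  linarith

/-- The covering homomorphism onto `SL(2, ℝ)`. -/
def toSL : SLTilde →* Matrix.SpecialLinearGroup (Fin 2) ℝ where
  toFun g := ⟨g.realMatrix, g.det_realMatrix⟩
  map_one' := by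
    ext i j
    fin_cases i <;> fin_cases j <;> simp [realMatrix, a_one, b_one]
  map_mul' g h := by
    refine Subtype.ext ?_
    change (g * h).realMatrix = g.realMatrix * h.realMatrix
    ext i j
    fin_cases i <;> fin_cases j <;>
      simp [realMatrix, a_mul, b_mul, Matrix.mul_apply, Fin.sum_univ_two] <;> ring

lemma coe_toSL (g : SLTilde) : (toSL g).1 = g.realMatrix := rfl

lemma toSL_eq_one {g : SLTilde} (h : toSL g = 1) : g.a = 1 ∧ g.b = 0 := by
  have h' : g.realMatrix = 1 := by rw [← coe_toSL, h]; rfl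
  have h00 := congrFun (congrFun h' 0) 0
  have h01 := congrFun (congrFun h' 0) 1
  have h10 := congrFun (congrFun h' 1) 0
  have h11 := congrFun (congrFun h' 1) 1
  simp [realMatrix] at h00 h01 h10 h11
  constructor <;> apply Complex.ext <;> simp <;> linarith

lemma toSL_isOpenQuotientMap : IsOpenQuotientMap toSL := by
  have hpos : ∀ w : ℂ, 0 < 1 + Complex.normSq w := fun w ↦ by
    linarith [Complex.normSq_nonneg w]
  let aM : Matrix.SpecialLinearGroup (Fin 2) ℝ → ℂ :=
    fun m ↦ ⟨(m.1 0 0 + m.1 1 1) / 2, (m.1 1 0 - m.1 0 1) / 2⟩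
  let bM : Matrix.SpecialLinearGroup (Fin 2) ℝ → ℂ :=
    fun m ↦ ⟨(m.1 0 0 - m.1 1 1) / 2, (m.1 1 0 + m.1 0 1) / 2⟩
  have hab : ∀ m, Complex.normSq (aM m) = 1 + Complex.normSq (bM m) := fun m ↦ by
    have := m.2
    rw [Matrix.det_fin_two] at this
    simp only [aM, bM, Complex.normSq_apply]
    linarith
  have haM0 : ∀ m, aM m ≠ 0 := fun m h ↦ by
    have := hab m
    rw [h, Complex.normSq_zero] at this
    linarith [hpos (bM m)]
  have hentry : ∀ i j, Continuous fun m : Matrix.SpecialLinearGroup (Fin 2) ℝ ↦ m.1 i j :=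
    fun i j ↦ (continuous_apply j).comp ((continuous_apply i).comp continuous_subtype_val)
  have haMc : Continuous aM := by
    have : aM = fun m ↦ Complex.equivRealProdCLM.symm
      ((m.1 0 0 + m.1 1 1) / 2, (m.1 1 0 - m.1 0 1) / 2) := by
      funext m; simp [aM, Complex.ext_iff]
    rw [this]
    exact Complex.equivRealProdCLM.symm.continuous.comp
      ((((hentry 0 0).add (hentry 1 1)).div_const 2).prodMk
        (((hentry 1 0).sub (hentry 0 1)).div_const 2))
  have hbMc : Continuous bM := by
    have : bM = fun m ↦ Complex.equivRealProdCLM.symm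
      ((m.1 0 0 - m.1 1 1) / 2, (m.1 1 0 + m.1 0 1) / 2) := by
      funext m; simp [bM, Complex.ext_iff]
    rw [this]
    exact Complex.equivRealProdCLM.symm.continuous.comp
      ((((hentry 0 0).sub (hentry 1 1)).div_const 2).prodMk
        (((hentry 1 0).add (hentry 0 1)).div_const 2))
  have hsq : ∀ w : ℂ, (√(1 + Complex.normSq w)) * (√(1 + Complex.normSq w)) =
    1 + Complex.normSq w := fun w ↦ Real.mul_self_sqrt (hpos w).le
  have hn : ∀ m, ‖aM m‖ = √(1 + Complex.normSq (bM m)) := fun m ↦ by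
    rw [← hab, Complex.normSq_eq_norm_sq, Real.sqrt_sq (norm_nonneg _)]
  have hs0 : ∀ w : ℂ, ((√(1 + Complex.normSq w) : ℝ) : ℂ) ≠ 0 := fun w ↦ by
    exact_mod_cast (Real.sqrt_pos.2 (hpos w)).ne'
  let E : Circle × ℂ → Matrix.SpecialLinearGroup (Fin 2) ℝ := fun p ↦
        ⟨!![√(1 + Complex.normSq p.2) * (p.1 : ℂ).re + p.2.re,
            p.2.im - √(1 + Complex.normSq p.2) * (p.1 : ℂ).im;
            p.2.im + √(1 + Complex.normSq p.2) * (p.1 : ℂ).im,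
            √(1 + Complex.normSq p.2) * (p.1 : ℂ).re - p.2.re], by
          have h1 := hsq p.2
          have h2 := Circle.normSq_coe p.1
          rw [Complex.normSq_apply] at h1 h2
          rw [Matrix.det_fin_two_of, Complex.normSq_apply]
          linear_combination h1 +
            √(1 + (p.2.re * p.2.re + p.2.im * p.2.im)) ^ 2 * h2⟩
  let e : Circle × ℂ ≃ₜ Matrix.SpecialLinearGroup (Fin 2) ℝ :=
    { toFun := E
      invFun := fun m ↦ (⟨aM m / (‖aM m‖ : ℝ), by
        simp [Submonoid.unitSphere, haM0 m]⟩, bM m)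
      left_inv := fun p ↦ by
        have ha : aM (E p) = √(1 + Complex.normSq p.2) * (p.1 : ℂ) := by
          apply Complex.ext <;> simp [aM, E]
        have hb : bM (E p) = p.2 := by
          apply Complex.ext <;> simp [bM, E]
        refine Prod.ext (Subtype.ext ?_) hb
        change aM (E p) / (‖aM (E p)‖ : ℝ) = p.1
        rw [hn, hb, ha]
        exact mul_div_cancel_left₀ _ (hs0 p.2)
      right_inv := fun m ↦ by
        have h0 := hs0 (bM m)
        have hre : √(1 + Complex.normSq (bM m)) * (aM m / (‖aM m‖ : ℝ)) = aM m := by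
          rw [hn]; field_simp
        have h1 := congrArg Complex.re hre
        have h2 := congrArg Complex.im hre
        rw [Complex.re_ofReal_mul] at h1
        rw [Complex.im_ofReal_mul] at h2
        apply Subtype.ext
        change !![√(1 + Complex.normSq (bM m)) * (aM m / (‖aM m‖ : ℝ)).re + (bM m).re,
            (bM m).im - √(1 + Complex.normSq (bM m)) * (aM m / (‖aM m‖ : ℝ)).im;
            (bM m).im + √(1 + Complex.normSq (bM m)) * (aM m / (‖aM m‖ : ℝ)).im,
            √(1 + Complex.normSq (bM m)) * (aM m / (‖aM m‖ : ℝ)).re - (bM m).re] = m.1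
        rw [h1, h2]
        ext i j
        fin_cases i <;> fin_cases j <;> simp [aM, bM] <;> ring
      continuous_toFun := by
        refine Continuous.subtype_mk (continuous_matrix fun i j ↦ ?_) _
        have c1 : Continuous fun p : Circle × ℂ ↦ √(1 + Complex.normSq p.2) :=
          (continuous_const.add (Complex.continuous_normSq.comp continuous_snd)).sqrt
        have c2 : Continuous fun p : Circle × ℂ ↦ (p.1 : ℂ).re :=
          Complex.continuous_re.comp (continuous_subtype_val.comp continuous_fst)
        have c3 : Continuous fun p : Circle × ℂ ↦ (p.1 : ℂ).im :=
          Complex.continuous_im.comp (continuous_subtype_val.comp continuous_fst)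
        have c4 : Continuous fun p : Circle × ℂ ↦ p.2.re :=
          Complex.continuous_re.comp continuous_snd
        have c5 : Continuous fun p : Circle × ℂ ↦ p.2.im :=
          Complex.continuous_im.comp continuous_snd
        fin_cases i <;> fin_cases j
        · exact (c1.mul c2).add c4
        · exact c5.sub (c1.mul c3)
        · exact c5.add (c1.mul c3)
        · exact (c1.mul c2).sub c4
      continuous_invFun := by
        refine Continuous.prodMk (Continuous.subtype_mk (haMc.div ?_ fun m ↦ ?_) _) hbMc
        · exact Complex.continuous_ofReal.comp (continuous_norm.comp haMc)
        · simpa using haM0 m }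
  have h1 : IsOpenQuotientMap (Prod.map Circle.exp id : ℝ × ℂ → Circle × ℂ) :=
    IsOpenQuotientMap.prodMap Circle.isAddQuotientCoveringMap_exp.isOpenQuotientMap .id
  have h2 := e.isOpenQuotientMap.comp h1
  have h3 : (e ∘ (Prod.map Circle.exp id : ℝ × ℂ → Circle × ℂ)) = (toSL : ℝ × ℂ → _) := by
    funext g
    apply Subtype.ext
    have h4 : ∀ w : ℝ × ℂ, a w = (√(1 + Complex.normSq w.2) : ℝ) * (Circle.exp w.1 : ℂ) :=
      fun w ↦ by rw [Circle.coe_exp]; rfl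
    change _ = realMatrix g
    simp only [realMatrix, h4, Complex.re_ofReal_mul, Complex.im_ofReal_mul]
    rfl
  rw [h3] at h2
  exact h2

/-- `SLTilde` is contractible (hence simply connected), and it covers `SL(2, ℝ)`. -/
lemma toSL_isCoveringMap : IsCoveringMap toSL := by
  have : IsTopologicalGroup SLTilde := topologicalGroup_of_lieGroup 𝓘(ℝ, ℝ × ℂ) ∞
  have hk : IsDiscrete (toSL.ker : Set SLTilde) := by
    rw [isDiscrete_iff_forall_mem_exists_isOpen]
    intro g hg
    refine ⟨{h | |h.1 - g.1| < 2 * Real.pi}, ?_, ?_⟩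
    · have : Continuous fun h : ℝ × ℂ ↦ |h.1 - g.1| := (continuous_fst.sub continuous_const).abs
      exact isOpen_lt this continuous_const
    · have hg' := toSL_eq_one hg
      ext h
      constructor
      · rintro ⟨h1, h2⟩
        have h2' := toSL_eq_one h2
        exact ext_of_abs_lt (h2'.1.trans hg'.1.symm) (h2'.2.trans hg'.2.symm) h1
      · rintro rfl
        exact ⟨by simp [Real.pi_pos], hg⟩
  exact (toSL_isOpenQuotientMap.isQuotientMap.isQuotientCoveringMap_of_isDiscrete_ker_monoidHom
    hk).isCoveringMap


/-- The matrix in `SU(1,1)` below `g`. -/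
def complexMatrix (g : SLTilde) : Matrix (Fin 2) (Fin 2) ℂ := !![g.a, g.b; conj g.b, conj g.a]

lemma complexMatrix_mul (g h : SLTilde) :
    (g * h).complexMatrix = g.complexMatrix * h.complexMatrix := by
  ext i j
  fin_cases i <;> fin_cases j <;>
    simp [complexMatrix, a_mul, b_mul, Matrix.mul_apply, Fin.sum_univ_two] <;> ring

/-- The generators `f₁, f₂, f₃` of the Lie algebra of `SU(1,1)`, the velocities at the unit of the
hyperbolic translations along the real and the imaginary axis of the disc and of the rotations about
its center. They satisfy `[f₁, f₂] = -4 f₃`, `[f₁, f₃] = -f₂`, `[f₂, f₃] = f₁`. -/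
def generator : Fin 3 → Matrix (Fin 2) (Fin 2) ℂ :=
  ![!![0, 1; 1, 0], !![0, I; -I, 0], !![I / 2, 0; 0, -I / 2]]

/-- The Lie algebra, that is the tangent space at the unit. -/
abbrev LieAlg : Type := GroupLieAlgebra 𝓘(ℝ, ℝ × ℂ) SLTilde

/-- An element of the Lie algebra in the chart `(t, b)`. -/
def toPair (v : LieAlg) : ℝ × ℂ := v

/-- The coordinates of an element of the Lie algebra in the basis `frame`. -/
def frameEquiv : LieAlg ≃ₗ[ℝ] (Fin 3 → ℝ) where
  toFun v := ![2 * (toPair v).2.re, 2 * (toPair v).2.im, 4 * (toPair v).1]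
  invFun c := ((c 2 / 4, ⟨c 0 / 2, c 1 / 2⟩) : ℝ × ℂ)
  map_add' v w := by
    have h1 : (toPair (v + w)).1 = (toPair v).1 + (toPair w).1 := rfl
    have h2 : (toPair (v + w)).2 = (toPair v).2 + (toPair w).2 := rfl
    ext i
    fin_cases i <;> simp [h1, h2] <;> ring
  map_smul' r v := by
    have h1 : (toPair (r • v)).1 = r * (toPair v).1 := rfl
    have h2 : (toPair (r • v)).2 = (r : ℂ) * (toPair v).2 := (Complex.real_smul).symm ▸ rfl
    ext i
    fin_cases i <;> simp [h1, h2] <;> ring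
  left_inv v := by
    change ((4 * (toPair v).1 / 4, ⟨2 * (toPair v).2.re / 2, 2 * (toPair v).2.im / 2⟩) : ℝ × ℂ)
      = toPair v
    refine Prod.ext ?_ (Complex.ext ?_ ?_) <;> simp
  right_inv c := by
    ext i
    fin_cases i <;> simp [toPair] <;> ring

/-- The basis `e₁, e₂, e₃` (indexed by `0, 1, 2`) of the Lie algebra that corresponds to
`f₁ / 2, f₂ / 2, f₃ / 2`, see `hasDerivAt_complexMatrix`. It is declared to be orthonormal
(`⟨f_j, f_k⟩ = 4 δ_jk`) and positively oriented. -/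
def frame : Module.Basis (Fin 3) ℝ LieAlg := .ofEquivFun frameEquiv

lemma frame_repr_apply (v : LieAlg) (k : Fin 3) :
    frame.repr v k = ![2 * (toPair v).2.re, 2 * (toPair v).2.im, 4 * (toPair v).1] k := by
  rw [frame, Module.Basis.ofEquivFun_repr_apply]
  rfl

lemma toPair_frame (j : Fin 3) :
    toPair (frame j) = (![(0, 1 / 2), (0, I / 2), (1 / 4, 0)] : Fin 3 → ℝ × ℂ) j := by
  have h : ∀ k, ![2 * (toPair (frame j)).2.re, 2 * (toPair (frame j)).2.im,
      4 * (toPair (frame j)).1] k = if j = k then 1 else 0 := fun k ↦ by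
    rw [← frame_repr_apply, Module.Basis.repr_self_apply]
  have h0 := h 0
  have h1 := h 1
  have h2 := h 2
  refine Prod.ext ?_ (Complex.ext ?_ ?_) <;> fin_cases j <;> simp at h0 h1 h2 ⊢ <;> linarith

lemma hasDerivAt_a (v : ℝ × ℂ) :
    HasDerivAt (fun t : ℝ ↦ a ((t • v : ℝ × ℂ))) (v.1 * I) 0 := by
  have h1 : HasDerivAt (fun t : ℝ ↦ √(1 + t ^ 2 * Complex.normSq v.2)) 0 0 := by
    have := ((((hasDerivAt_id (0 : ℝ)).pow 2).mul_const (Complex.normSq v.2)).const_add 1).sqrt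
      (by simp)
    simpa using this
  have h2 : HasDerivAt (fun t : ℝ ↦ Complex.exp (((t * v.1 : ℝ) : ℂ) * I)) (v.1 * I) 0 := by
    have := (((hasDerivAt_id (0 : ℝ)).mul_const v.1).ofReal_comp.mul_const I).cexp
    simpa using this
  have h3 := h1.ofReal_comp.mul h2
  have h4 : (fun t : ℝ ↦ a ((t • v : ℝ × ℂ))) = fun t : ℝ ↦
      ((√(1 + t ^ 2 * Complex.normSq v.2) : ℝ) : ℂ) * Complex.exp (((t * v.1 : ℝ) : ℂ) * I) := by
    funext t
    simp [a, pow_two]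
  rw [h4]
  refine h3.congr_deriv ?_
  simp

lemma hasDerivAt_b (v : ℝ × ℂ) :
    HasDerivAt (fun t : ℝ ↦ b ((t • v : ℝ × ℂ))) v.2 0 := by
  have := (hasDerivAt_id (0 : ℝ)).smul_const v.2
  simpa [b] using this

/-- Under the differential of the projection to matrices, `e_j` is mapped to `f_j / 2`. -/
lemma hasDerivAt_complexMatrix (j : Fin 3) (r s : Fin 2) :
    HasDerivAt (fun t : ℝ ↦ complexMatrix ((t • toPair (frame j)) : ℝ × ℂ) r s)
      (((1 / 2 : ℂ) • generator j) r s) 0 := by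
  have ha := hasDerivAt_a (toPair (frame j))
  have hb := hasDerivAt_b (toPair (frame j))
  have ha' : HasDerivAt (fun t : ℝ ↦ conj (a (t • toPair (frame j) : ℝ × ℂ))) _ 0 := ha.star
  have hb' : HasDerivAt (fun t : ℝ ↦ conj (b (t • toPair (frame j) : ℝ × ℂ))) _ 0 := hb.star
  rw [toPair_frame] at *
  fin_cases r <;> fin_cases s
  · refine ha.congr_deriv ?_
    fin_cases j <;> simp [generator]; ring
  · refine hb.congr_deriv ?_
    fin_cases j <;> simp [generator]; ring
  · refine hb'.congr_deriv ?_
    fin_cases j <;> simp [generator]; ring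
  · refine ha'.congr_deriv ?_
    fin_cases j <;> simp [generator]; ring

lemma mulInvariantVectorField_apply (v : LieAlg) (g : SLTilde) :
    mulInvariantVectorField v g =
      (((toPair v).1 + (g.b * conj (toPair v).2 / g.a).im,
        g.a * (toPair v).2 - I * (toPair v).1 * g.b) : ℝ × ℂ) := by
  let F : ℝ × ℂ → ℝ × ℂ := fun h ↦
    (g.1 + h.1 + (corr g h).arg, a g * b h + b g * conj (a h))
  have hd : DifferentiableAt ℝ F 0 := by
    have h1 := contDiff_mul_aux.differentiable (by simp)
    have h2 := h1.comp ((differentiable_const (toPair g)).prodMk differentiable_id)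
    exact h2 0
  have e1 : mulInvariantVectorField v g = fderiv ℝ F 0 (toPair v) := by
    rw [mulInvariantVectorField]
    exact congrArg (fun L : (ℝ × ℂ) →L[ℝ] (ℝ × ℂ) ↦ L (toPair v)) mfderiv_eq_fderiv
  rw [e1]
  have hl : HasDerivAt (fun t : ℝ ↦ t • toPair v) (toPair v) 0 := by
    simpa using (hasDerivAt_id (0 : ℝ)).smul_const (toPair v)
  have hF := HasFDerivAt.comp_hasDerivAt_of_eq (0 : ℝ) hd.hasFDerivAt hl (by simp)
  refine hF.unique ?_
  have ha := hasDerivAt_a (toPair v)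
  have hb := hasDerivAt_b (toPair v)
  have ha' : HasDerivAt (fun t : ℝ ↦ conj (a (t • toPair v : ℝ × ℂ))) _ 0 := ha.star
  have hb' : HasDerivAt (fun t : ℝ ↦ conj (b (t • toPair v : ℝ × ℂ))) _ 0 := hb.star
  have z1 : a (((0 : ℝ) • toPair v : ℝ × ℂ)) = 1 := by rw [zero_smul]; exact a_one
  have z2 : b (((0 : ℝ) • toPair v : ℝ × ℂ)) = 0 := by rw [zero_smul]; exact b_one
  have hc : HasDerivAt (fun t : ℝ ↦ corr g (t • toPair v : ℝ × ℂ))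
      (g.b * conj (toPair v).2 / g.a) 0 := by
    have := ((hb'.const_mul g.b).div (ha.const_mul g.a)
      (mul_ne_zero (a_ne_zero g) (a_ne_zero _))).const_add 1
    refine this.congr_deriv ?_
    have := a_ne_zero g
    simp only [z1, z2]
    simp
    field_simp
  have hlog := hc.clog_real (by
    have := corr_re_pos g ((0 : ℝ) • toPair v : ℝ × ℂ)
    exact Or.inl this)
  have hcz : corr g ((0 : ℝ) • toPair v : ℝ × ℂ) = 1 := by
    simp only [corr, z1, z2]; simp
  rw [hcz, div_one] at hlog
  have harg := Complex.imCLM.hasFDerivAt.comp_hasDerivAt (0 : ℝ) hlog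
  have ht : HasDerivAt (fun t : ℝ ↦ g.1 + t * (toPair v).1) (toPair v).1 0 := by
    simpa using ((hasDerivAt_id (0 : ℝ)).mul_const (toPair v).1).const_add g.1
  have h2 := (ha'.const_mul g.b)
  have h3 := (hb.const_mul g.a).add h2
  refine ((ht.add harg).prodMk h3).congr_deriv ?_ |>.congr_of_eventuallyEq ?_
  · refine Prod.ext ?_ ?_
    · simp
    · simp; ring
  · refine Filter.Eventually.of_forall fun t ↦ ?_
    refine Prod.ext ?_ rfl
    simp only [Function.comp]
    change g.1 + t * (toPair v).1 + (corr g _).arg = _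
    simp [Complex.log_im]

lemma mlieBracket_modelSpace (V W : ∀ x : ℝ × ℂ, TangentSpace 𝓘(ℝ, ℝ × ℂ) x) (x : ℝ × ℂ) :
    VectorField.mlieBracket 𝓘(ℝ, ℝ × ℂ) (M := ℝ × ℂ) V W x = VectorField.lieBracket ℝ V W x := by
  have h1 := congrFun (VectorField.mlieBracketWithin_univ (I := 𝓘(ℝ, ℝ × ℂ)) (V := V) (W := W)) x
  have h2 := congrFun
    (VectorField.mlieBracketWithin_eq_lieBracketWithin (V := V) (W := W) (s := Set.univ)) x
  have h3 := congrFun (VectorField.lieBracketWithin_univ (𝕜 := ℝ) (V := V) (W := W)) x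
  exact h1.symm.trans (h2.trans h3)

lemma lie_apply (v w : LieAlg) :
    ⁅v, w⁆ = ((2 * ((toPair v).2 * conj (toPair w).2).im,
      2 * I * ((toPair v).1 * (toPair w).2 -
        (toPair w).1 * (toPair v).2)) : ℝ × ℂ) := by
  let V : LieAlg → ℝ × ℂ → ℝ × ℂ := fun v g ↦
    ((toPair v).1 + (b g * conj (toPair v).2 / a g).im,
        a g * (toPair v).2 - I * (toPair v).1 * b g)
  have hV : ∀ v, mulInvariantVectorField v = V v := fun v ↦
    funext (mulInvariantVectorField_apply v)
  have hVd : ∀ v, DifferentiableAt ℝ (V v) 0 := fun v ↦ by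
    have a1 : DifferentiableAt ℝ (fun g : ℝ × ℂ ↦ a g) 0 := contDiff_a.differentiable (by simp) 0
    have b1 : DifferentiableAt ℝ (fun g : ℝ × ℂ ↦ b g) 0 := differentiable_snd 0
    have h1 := (Complex.imCLM.differentiableAt.comp (0 : ℝ × ℂ)
      (((b1.mul_const (conj (toPair v).2)).mul (a1.inv (a_ne_zero _))))).const_add (toPair v).1
    have h2 := (a1.mul_const (toPair v).2).sub (b1.const_mul (I * (toPair v).1))
    exact h1.prodMk h2
  have hV0 : ∀ v, V v 0 = toPair v := fun v ↦ by
    have z1 : a (0 : ℝ × ℂ) = 1 := a_one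
    have z2 : b (0 : ℝ × ℂ) = 0 := b_one
    simp [V, z1, z2]
  have hD : ∀ v w, fderiv ℝ (V w) 0 (toPair v) =
      (((toPair v).2 * conj (toPair w).2).im,
        I * (toPair v).1 * (toPair w).2 - I * (toPair w).1 * (toPair v).2) := fun v w ↦ by
    have hl : HasDerivAt (fun t : ℝ ↦ t • toPair v) (toPair v) 0 := by
      simpa using (hasDerivAt_id (0 : ℝ)).smul_const (toPair v)
    have hF := HasFDerivAt.comp_hasDerivAt_of_eq (0 : ℝ) (hVd w).hasFDerivAt hl (by simp)
    refine hF.unique ?_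
    have ha := hasDerivAt_a (toPair v)
    have hb := hasDerivAt_b (toPair v)
    have z1 : a (((0 : ℝ) • toPair v : ℝ × ℂ)) = 1 := by rw [zero_smul]; exact a_one
    have z2 : b (((0 : ℝ) • toPair v : ℝ × ℂ)) = 0 := by rw [zero_smul]; exact b_one
    have h1 := (Complex.imCLM.hasFDerivAt.comp_hasDerivAt (0 : ℝ)
      ((hb.mul_const (conj (toPair w).2)).div ha (a_ne_zero _))).const_add (toPair w).1
    have h2 := (ha.mul_const (toPair w).2).sub (hb.const_mul (I * (toPair w).1))
    refine (h1.prodMk h2).congr_deriv ?_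
    refine Prod.ext ?_ ?_
    · rw [z1, z2]; simp
    · simp only [mul_comm I]
  have hb : ⁅v, w⁆ = VectorField.lieBracket ℝ (V v) (V w) 0 := by
    rw [GroupLieAlgebra.bracket_def, hV, hV]
    exact mlieBracket_modelSpace (V v) (V w) 0
  rw [hb, VectorField.lieBracket, hV0, hV0, hD, hD]
  refine Prod.ext ?_ ?_
  · simp; ring
  · simp; ring

lemma toPair_lie (v w : LieAlg) :
    toPair ⁅v, w⁆ = (2 * ((toPair v).2 * conj (toPair w).2).im,
      2 * I * ((toPair v).1 * (toPair w).2 - (toPair w).1 * (toPair v).2)) := lie_apply v w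

/-- The commutation relations of the basis. -/
lemma lie_frame : ⁅frame 0, frame 1⁆ = (-2 : ℝ) • frame 2 ∧
    ⁅frame 0, frame 2⁆ = (-(1 / 2) : ℝ) • frame 1 ∧ ⁅frame 1, frame 2⁆ = (1 / 2 : ℝ) • frame 0 := by
  have h0 : toPair (frame 0) = (0, 1 / 2) := toPair_frame 0
  have h1 : toPair (frame 1) = (0, I / 2) := toPair_frame 1
  have h2 : toPair (frame 2) = (1 / 4, 0) := toPair_frame 2
  refine ⟨?_, ?_, ?_⟩ <;>
  · apply frame.repr.injective
    ext k
    rw [frame_repr_apply, toPair_lie, map_smul, Finsupp.smul_apply, Module.Basis.repr_self_apply]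
    simp only [h0, h1, h2]
    fin_cases k <;> (simp [map_ofNat]; try norm_num)

/-- The structure constants `⟨[e_i, e_j], e_k⟩`. -/
def structConst (i j k : Fin 3) : ℝ := frame.repr ⁅frame i, frame j⁆ k

/-- The coefficients of the Levi-Civita connection of the left invariant metric in the left invariant
orthonormal frame, by the Koszul formula: `∇_{e_k} e_j = ∑ i, connCoeff k j i • e_i`. -/
def connCoeff (k j i : Fin 3) : ℝ :=
  (structConst k j i + structConst i k j + structConst i j k) / 2

lemma structConst_antisymm (i j k : Fin 3) : structConst i j k = -structConst j i k := by
  simp only [structConst, frame_repr_apply, toPair_lie]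
  fin_cases k <;> simp <;> ring

/-- The connection is torsion-free. -/
lemma connCoeff_torsion (k j i : Fin 3) :
    connCoeff k j i - connCoeff j k i = structConst k j i := by
  simp only [connCoeff]
  rw [structConst_antisymm j k i]
  ring

/-- The connection is compatible with the metric. -/
lemma connCoeff_metric (k j i : Fin 3) : connCoeff k j i = -connCoeff k i j := by
  simp only [connCoeff]
  rw [structConst_antisymm k j i, structConst_antisymm i k j, structConst_antisymm i j k]
  ring

/-- The coordinates of `∇_u v` for left invariant vector fields `u` and `v`, given by their
coordinates in the frame; for `R = ℂ` this is the complex bilinear extension. -/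
def nabla {R : Type*} [CommRing R] [Algebra ℝ R] (u v : Fin 3 → R) (i : Fin 3) : R :=
  ∑ k, ∑ j, connCoeff k j i • (u k * v j)

/-- The coordinates in the frame `e₁, e₂, e₃` of the left translate `g⁻¹ v` to the unit of a vector `v`
tangent at `g`. -/
def coords (g : SLTilde) (v : TangentSpace 𝓘(ℝ, ℝ × ℂ) g) : Fin 3 → ℝ :=
  frame.repr (mfderiv 𝓘(ℝ, ℝ × ℂ) 𝓘(ℝ, ℝ × ℂ) (fun h ↦ g⁻¹ * h) g v)

/-- The left invariant Riemannian metric for which `e₁, e₂, e₃` are orthonormal. -/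
def metric (g : SLTilde) (v w : TangentSpace 𝓘(ℝ, ℝ × ℂ) g) : ℝ := coords g v ⬝ᵥ coords g w

/-- The left invariant frame is orthonormal. -/
lemma metric_frame (g : SLTilde) (j k : Fin 3) :
    metric g (mulInvariantVectorField (frame j) g) (mulInvariantVectorField (frame k) g) =
      if j = k then 1 else 0 := by
  have h : ∀ v : LieAlg, coords g (mulInvariantVectorField v g) = frame.repr v := fun v ↦ by
    have e1 : ∀ x, x = g * 1 →
        (mfderiv 𝓘(ℝ, ℝ × ℂ) 𝓘(ℝ, ℝ × ℂ) (fun h : SLTilde ↦ g⁻¹ * h) x : (ℝ × ℂ) →L[ℝ] (ℝ × ℂ)) =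
          mfderiv 𝓘(ℝ, ℝ × ℂ) 𝓘(ℝ, ℝ × ℂ) (fun h : SLTilde ↦ g⁻¹ * h) (g * 1) := by
      rintro _ rfl
      rfl
    have e2 := mfderiv_comp (I := 𝓘(ℝ, ℝ × ℂ)) (I' := 𝓘(ℝ, ℝ × ℂ)) (I'' := 𝓘(ℝ, ℝ × ℂ))
      (1 : SLTilde) (g := fun h : SLTilde ↦ g⁻¹ * h) (f := fun h : SLTilde ↦ g * h)
      ((contMDiff_mul_left (n := ∞)).mdifferentiableAt (by simp))
      ((contMDiff_mul_left (n := ∞)).mdifferentiableAt (by simp))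
    have e3 : (fun h : SLTilde ↦ g⁻¹ * h) ∘ (fun h : SLTilde ↦ g * h) = id := by
      funext h
      simp
    rw [e3, mfderiv_id] at e2
    have e4 : ∀ L : (ℝ × ℂ) →L[ℝ] (ℝ × ℂ), L =
        mfderiv 𝓘(ℝ, ℝ × ℂ) 𝓘(ℝ, ℝ × ℂ) (fun h : SLTilde ↦ g⁻¹ * h) (g * 1) →
        L (mulInvariantVectorField v g) = v := by
      rintro _ rfl
      exact (congrArg (fun L : (ℝ × ℂ) →L[ℝ] (ℝ × ℂ) ↦ L v) e2).symm
    exact congrArg (fun x : LieAlg ↦ (frame.repr x : Fin 3 → ℝ)) (e4 _ (e1 g (mul_one g).symm))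
  rw [metric, h, h]
  simp only [dotProduct, Module.Basis.repr_self_apply]
  fin_cases j <;> fin_cases k <;> simp

variable {M : Type*} [TopologicalSpace M] [ChartedSpace ℂ M]

/-- A smooth immersed surface. The surface `M` is a smooth real two-dimensional manifold. -/
structure IsSmoothImmersion (f : M → SLTilde) : Prop where
  smooth : ContMDiff 𝓘(ℝ, ℂ) 𝓘(ℝ, ℝ × ℂ) ∞ f
  injective_mfderiv : ∀ p, Function.Injective (mfderiv 𝓘(ℝ, ℂ) 𝓘(ℝ, ℝ × ℂ) f p)

/-- The coordinates of `f⁻¹ df(u)`. -/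
def diffCoords (f : M → SLTilde) (p : M) (u : TangentSpace 𝓘(ℝ, ℂ) p) : Fin 3 → ℝ :=
  coords (f p) (mfderiv 𝓘(ℝ, ℂ) 𝓘(ℝ, ℝ × ℂ) f p u)

/-- The coordinates of `f⁻¹ N`, for a vector field `N` along `f`. -/
def normalCoords (f : M → SLTilde) (N : ∀ p, TangentSpace 𝓘(ℝ, ℝ × ℂ) (f p)) (p : M) :
    Fin 3 → ℝ := coords (f p) (N p)

/-- `N` is a smooth unit normal field along the surface. -/
structure IsUnitNormalField (f : M → SLTilde) (N : ∀ p, TangentSpace 𝓘(ℝ, ℝ × ℂ) (f p)) :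
    Prop where
  smooth : ContMDiff 𝓘(ℝ, ℂ) 𝓘(ℝ, Fin 3 → ℝ) ∞ (normalCoords f N)
  orthogonal : ∀ p (u : TangentSpace 𝓘(ℝ, ℂ) p),
    metric (f p) (N p) (mfderiv 𝓘(ℝ, ℂ) 𝓘(ℝ, ℝ × ℂ) f p u) = 0
  unit : ∀ p, metric (f p) (N p) (N p) = 1

/-- The first fundamental form. -/
def inducedMetric (f : M → SLTilde) (p : M) (u v : TangentSpace 𝓘(ℝ, ℂ) p) : ℝ :=
  metric (f p) (mfderiv 𝓘(ℝ, ℂ) 𝓘(ℝ, ℝ × ℂ) f p u) (mfderiv 𝓘(ℝ, ℂ) 𝓘(ℝ, ℝ × ℂ) f p v)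

/-- The coordinates of `f⁻¹ (∇_u N)`, the Levi-Civita derivative of the vector field `N` along `f`. -/
def covDerivNormal (f : M → SLTilde) (N : ∀ p, TangentSpace 𝓘(ℝ, ℝ × ℂ) (f p)) (p : M)
    (u : TangentSpace 𝓘(ℝ, ℂ) p) : Fin 3 → ℝ :=
  fun i ↦ (mfderiv 𝓘(ℝ, ℂ) 𝓘(ℝ, Fin 3 → ℝ) (normalCoords f N) p u : Fin 3 → ℝ) i +
    nabla (diffCoords f p u) (normalCoords f N p) i

/-- The second fundamental form `⟨∇_u df(v), N⟩ = -⟨∇_u N, df(v)⟩`. -/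
def secondFundamentalForm (f : M → SLTilde) (N : ∀ p, TangentSpace 𝓘(ℝ, ℝ × ℂ) (f p)) (p : M)
    (u v : TangentSpace 𝓘(ℝ, ℂ) p) : ℝ :=
  -(covDerivNormal f N p u ⬝ᵥ diffCoords f p v)

/-- `H` is the mean curvature at `p` with respect to `N`: half of the trace of the second fundamental
form with respect to the first one. -/
def HasMeanCurvatureAt (f : M → SLTilde) (N : ∀ p, TangentSpace 𝓘(ℝ, ℝ × ℂ) (f p)) (H : ℝ)
    (p : M) : Prop :=
  ∀ u v : TangentSpace 𝓘(ℝ, ℂ) p,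
    inducedMetric f p u u = 1 → inducedMetric f p v v = 1 → inducedMetric f p u v = 0 →
      H = (secondFundamentalForm f N p u u + secondFundamentalForm f N p v v) / 2

/-- The coordinates of `f⁻¹ ∂f/∂x` in the local parameter `φ = x + iy`. -/
def partialX (f : M → SLTilde) (φ : OpenPartialHomeomorph M ℂ) (w : ℂ) : Fin 3 → ℝ :=
  diffCoords (f ∘ φ.symm) w (1 : ℂ)

/-- The coordinates of `f⁻¹ ∂f/∂y` in the local parameter `φ = x + iy`. -/
def partialY (f : M → SLTilde) (φ : OpenPartialHomeomorph M ℂ) (w : ℂ) : Fin 3 → ℝ :=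
  diffCoords (f ∘ φ.symm) w I

/-- `φ = x + iy` is a smooth conformal parameter on an open subset of the surface, and it is positive:
`(∂f/∂x, ∂f/∂y, N)` is a positively oriented frame, that is `N` is the normal given by the parameter. -/
structure IsConformalParameter (f : M → SLTilde) (N : ∀ p, TangentSpace 𝓘(ℝ, ℝ × ℂ) (f p))
    (φ : OpenPartialHomeomorph M ℂ) : Prop where
  mem_maximalAtlas : φ ∈ IsManifold.maximalAtlas 𝓘(ℝ, ℂ) ∞ M
  conformal : ∀ w ∈ φ.target,
    partialX f φ w ⬝ᵥ partialX f φ w = partialY f φ w ⬝ᵥ partialY f φ w ∧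
    partialX f φ w ⬝ᵥ partialY f φ w = 0
  positive : ∀ w ∈ φ.target,
    0 < (Matrix.of ![partialX f φ w, partialY f φ w, normalCoords f N (φ.symm w)]).det

/-- The operator `∂ = (∂/∂x - i ∂/∂y) / 2`. -/
def wirtinger (h : ℂ → ℂ) (w : ℂ) : ℂ := (fderiv ℝ h w 1 - I * fderiv ℝ h w I) / 2

/-- The coefficients in `f⁻¹ ∂f = ∑ k, Z_k e_k`. The third one is `Z f φ w 2`. -/
def Z (f : M → SLTilde) (φ : OpenPartialHomeomorph M ℂ) (w : ℂ) (k : Fin 3) : ℂ :=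
  ((partialX f φ w k : ℂ) - I * (partialY f φ w k : ℂ)) / 2

/-- The coefficient `A = ⟨∇_{f_z} f_z, N⟩` of the Hopf differential. -/
def hopfCoeff (f : M → SLTilde) (N : ∀ p, TangentSpace 𝓘(ℝ, ℝ × ℂ) (f p))
    (φ : OpenPartialHomeomorph M ℂ) (w : ℂ) : ℂ :=
  ∑ i, (wirtinger (fun ζ ↦ Z f φ ζ i) w + nabla (Z f φ w) (Z f φ w) i) *
    (normalCoords f N (φ.symm w) i : ℂ)

/-- The coefficient `A + 5 Z₃² / (2 (H - i))`. -/
def abreschCoeff (f : M → SLTilde) (N : ∀ p, TangentSpace 𝓘(ℝ, ℝ × ℂ) (f p)) (H : ℝ)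
    (φ : OpenPartialHomeomorph M ℂ) (w : ℂ) : ℂ :=
  hopfCoeff f N φ w + 5 / (2 * ((H : ℂ) - I)) * Z f φ w 2 ^ 2

/-- The functions `q φ`, for the local parameters `φ` in `P`, are the coefficients of a holomorphic
quadratic differential `q dz²`: changes of parameters are holomorphic, the coefficients are related
by `q_z = q_w (dw/dz)²`, and each of them is a holomorphic function of the parameter. -/
structure IsHolomorphicQuadraticDifferential (P : Set (OpenPartialHomeomorph M ℂ))
    (q : OpenPartialHomeomorph M ℂ → ℂ → ℂ) : Prop where
  transform : ∀ φ ∈ P, ∀ ψ ∈ P, ∀ p ∈ φ.source ∩ ψ.source, ∃ c : ℂ,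
    HasDerivAt (ψ ∘ φ.symm) c (φ p) ∧ q φ (φ p) = q ψ (ψ p) * c ^ 2
  holomorphic : ∀ φ ∈ P, DifferentiableOn ℂ (q φ) φ.target

end SLTilde

end

/-!
In the left invariant frame the Levi-Civita connection is `∇_u v = ((5/2) u₃ e₃ - u) × v`, so that
the curvature is `R(u, v) w = (5 (u × v)₃ e₃ - u × v) × w`. Put `λ = ⟨f_z, f_z̄⟩`. Conformality and
constant mean curvature give `∇_z̄ f_z = H λ N`, and hence the Codazzi equation
`∂̄A = ⟨R(f_z̄, f_z) f_z, N⟩ = -5 λ Z₃ N₃`. The third component of `∇_z̄ f_z = H λ N` reads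
`∂̄Z₃ = (H - i) λ N₃`. Therefore `∂̄(Z₃²) = 2 (H - i) λ Z₃ N₃`, and the terms of `∂̄Ã` cancel.

Rotation by a right angle in the tangent planes is `N × ·`, and it takes `f_x` to `f_y` for every
positive conformal parameter; so changes of parameters satisfy the Cauchy–Riemann equations. Under
such a change both `Z` and the `dz`-part of `∇N` are multiplied by `dw/dz`, and
`A = -⟨∇_{∂z} N, f_z⟩`.
-/

noncomputable section

namespace SLTilde

section Connection

variable {R : Type*} [CommRing R] [Algebra ℝ R]

lemma connCoeff_table :
    connCoeff = ![![![0, 0, 0], ![0, 0, -1], ![0, 1, 0]], ![![0, 0, 1], ![0, 0, 0], ![-1, 0, 0]],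
      ![![0, 3 / 2, 0], ![-(3 / 2), 0, 0], ![0, 0, 0]]] := by
  have h0 : toPair (frame 0) = (0, 1 / 2) := toPair_frame 0
  have h1 : toPair (frame 1) = (0, I / 2) := toPair_frame 1
  have h2 : toPair (frame 2) = (1 / 4, 0) := toPair_frame 2
  funext k j i
  simp only [connCoeff, structConst, frame_repr_apply, toPair_lie]
  fin_cases k <;> fin_cases j <;> fin_cases i <;> simp [h0, h1, h2, map_ofNat] <;> norm_num

lemma nabla_eq_cross (u v : Fin 3 → R) :
    nabla u v = (Pi.single 2 ((5 / 2 : ℝ) • u 2) - u) ⨯₃ v := by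
  funext i
  simp only [nabla, connCoeff_table, Fin.sum_univ_three, cross_apply, Algebra.smul_def]
  have h : algebraMap ℝ R (5 / 2) = 1 + algebraMap ℝ R (3 / 2) := by
    rw [← map_one (algebraMap ℝ R), ← map_add]; norm_num
  fin_cases i <;> simp [h] <;> ring

variable (R) in
/-- The coefficients of the connection as a bilinear map. -/
def nablaBilin : (Fin 3 → R) →ₗ[R] (Fin 3 → R) →ₗ[R] (Fin 3 → R) :=
  LinearMap.mk₂ R nabla
    (fun u u' v ↦ by
      simp only [nabla_eq_cross, Pi.add_apply, smul_add, Pi.single_add, ← LinearMap.add_apply,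
        ← map_add]
      congr 2; abel)
    (fun c u v ↦ by
      simp only [nabla_eq_cross, Pi.smul_apply, smul_comm _ c, Pi.single_smul, ← smul_sub,
        LinearMap.smul_apply, map_smul])
    (fun u v v' ↦ by simp only [nabla_eq_cross, map_add])
    (fun c u v ↦ by simp only [nabla_eq_cross, map_smul])

lemma nabla_dotProduct_comm (u v w : Fin 3 → R) : nabla u v ⬝ᵥ w = -(v ⬝ᵥ nabla u w) := by
  rw [nabla_eq_cross, nabla_eq_cross, dotProduct_comm, triple_product_permutation,
    triple_product_permutation, ← cross_anticomm, dotProduct_neg]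

/-- The curvature tensor `R(u, v) w = ∇_u ∇_v w - ∇_v ∇_u w - ∇_[u,v] w` on left invariant fields,
where `[u, v] = ∇_u v - ∇_v u`. -/
def curvature (u v w : Fin 3 → R) : Fin 3 → R :=
  nabla u (nabla v w) - nabla v (nabla u w) - nabla (nabla u v - nabla v u) w

lemma curvature_eq_cross (u v w : Fin 3 → R) :
    curvature u v w = (Pi.single 2 (5 * (u ⨯₃ v) 2) - u ⨯₃ v) ⨯₃ w := by
  have h : 2 * algebraMap ℝ R (5 / 2) = 5 := by
    rw [← map_ofNat (algebraMap ℝ R) 2, ← map_mul, mul_div_cancel₀ _ two_ne_zero, map_ofNat]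
  funext i
  simp only [curvature, nabla_eq_cross, cross_apply, Algebra.smul_def]
  fin_cases i <;> simp only [Fin.isValue, Fin.zero_eta, Fin.mk_one, Fin.reduceFinMk, Pi.sub_apply,
    ne_eq, Fin.reduceEq, not_false_eq_true, Pi.single_eq_of_ne, Pi.single_eq_same, zero_sub,
    neg_mul, sub_neg_eq_add, Matrix.cons_val]
  · linear_combination w 1 * (u 1 * v 0 - v 1 * u 0) * h
  · linear_combination w 0 * (v 1 * u 0 - u 1 * v 0) * h
  · ring

end Connection

/-- The configuration of a vector `Z` and its conjugate `Zb` spanning the complexified orthogonal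
complement of a unit vector `n`: the cross product with `n` acts as `i` on `Z` and as `-i` on `Zb`.
That `Z` and `Zb` are isotropic and `n` is a unit vector follows. -/
structure IsNullFrame (Z Zb n : Fin 3 → ℂ) : Prop where
  cross_left : n ⨯₃ Z = I • Z
  cross_right : n ⨯₃ Zb = -I • Zb
  dotProduct_ne_zero : Z ⬝ᵥ Zb ≠ 0

namespace IsNullFrame

variable {Z Zb n : Fin 3 → ℂ}

lemma symm (h : IsNullFrame Z Zb n) : IsNullFrame Zb Z (-n) where
  cross_left := by rw [map_neg, LinearMap.neg_apply, h.cross_right, neg_smul, neg_neg]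
  cross_right := by rw [map_neg, LinearMap.neg_apply, h.cross_left, neg_smul]
  dotProduct_ne_zero := dotProduct_comm Z Zb ▸ h.dotProduct_ne_zero

lemma dotProduct_left_self (h : IsNullFrame Z Zb n) : Z ⬝ᵥ Z = 0 := by
  simpa [h.cross_left] using dot_cross_self n Z

lemma normal_dotProduct_left (h : IsNullFrame Z Zb n) : n ⬝ᵥ Z = 0 := by
  simpa [h.cross_left] using dot_self_cross n Z

lemma normal_dotProduct_right (h : IsNullFrame Z Zb n) : n ⬝ᵥ Zb = 0 := by
  simpa using h.symm.normal_dotProduct_left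

lemma dotProduct_right_self (h : IsNullFrame Z Zb n) : Zb ⬝ᵥ Zb = 0 :=
  h.symm.dotProduct_left_self

lemma cross_right_left (h : IsNullFrame Z Zb n) : Zb ⨯₃ Z = (-I * (Z ⬝ᵥ Zb)) • n := by
  have hZ : Z = -I • (n ⨯₃ Z) := by
    rw [h.cross_left, smul_smul, neg_mul, Complex.I_mul_I, neg_neg, one_smul]
  conv_lhs => rw [hZ, map_smul, cross_cross_eq_smul_sub_smul']
  rw [h.normal_dotProduct_right, zero_smul, sub_zero, smul_smul,
    dotProduct_comm]

lemma normal_dotProduct_self (h : IsNullFrame Z Zb n) : n ⬝ᵥ n = 1 := by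
  have hn : (n ⬝ᵥ n) • Z = Z := by
    have := cross_cross_eq_smul_sub_smul' n n Z
    rw [h.cross_left, map_smul, h.cross_left, smul_smul, Complex.I_mul_I,
      h.normal_dotProduct_left, zero_smul, zero_sub, neg_one_smul] at this
    exact (neg_injective this).symm
  refine mul_right_cancel₀ h.dotProduct_ne_zero ?_
  rw [one_mul, ← smul_eq_mul, ← smul_dotProduct, hn]

lemma smul_eq_expansion (h : IsNullFrame Z Zb n) (u : Fin 3 → ℂ) :
    (Z ⬝ᵥ Zb) • u = (u ⬝ᵥ Zb) • Z + (u ⬝ᵥ Z) • Zb + ((Z ⬝ᵥ Zb) * (u ⬝ᵥ n)) • n := by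
  have cramer : (n ⬝ᵥ Zb ⨯₃ Z) • u =
      (u ⬝ᵥ n ⨯₃ Zb) • Z - (u ⬝ᵥ n ⨯₃ Z) • Zb + (u ⬝ᵥ Zb ⨯₃ Z) • n := by
    ext i
    fin_cases i <;> simp [cross_apply, dotProduct, Fin.sum_univ_three] <;> ring
  rw [h.cross_left, h.cross_right, h.cross_right_left] at cramer
  simp only [dotProduct_smul, h.normal_dotProduct_self, smul_eq_mul] at cramer
  ext i
  have hi := congrFun cramer i
  simp only [Pi.smul_apply, Pi.add_apply, Pi.sub_apply, smul_eq_mul] at hi ⊢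
  linear_combination I * hi + (Z ⬝ᵥ Zb * u i - u ⬝ᵥ Zb * Z i - u ⬝ᵥ Z * Zb i -
    Z ⬝ᵥ Zb * u ⬝ᵥ n * n i) * Complex.I_sq

lemma ext_dotProduct (h : IsNullFrame Z Zb n) {u v : Fin 3 → ℂ} (hZ : u ⬝ᵥ Z = v ⬝ᵥ Z)
    (hZb : u ⬝ᵥ Zb = v ⬝ᵥ Zb) (hn : u ⬝ᵥ n = v ⬝ᵥ n) : u = v := by
  refine smul_right_injective _ h.dotProduct_ne_zero ?_
  simp only [h.smul_eq_expansion, hZ, hZb, hn]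

lemma mul_dotProduct_of_isotropic (h : IsNullFrame Z Zb n) {u v : Fin 3 → ℂ} (hu : u ⬝ᵥ Z = 0)
    (hv : v ⬝ᵥ n = 0) : Z ⬝ᵥ Zb * u ⬝ᵥ v = u ⬝ᵥ Zb * v ⬝ᵥ Z := by
  have := congrArg (u ⬝ᵥ ·) (h.smul_eq_expansion v)
  simpa [dotProduct_add, dotProduct_smul, hu, hv, mul_comm] using this

lemma nabla_right_left_two (h : IsNullFrame Z Zb n) :
    nabla Zb Z 2 = I * (Z ⬝ᵥ Zb) * n 2 := by
  rw [nabla_eq_cross, map_sub, LinearMap.sub_apply, h.cross_right_left]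
  simp [cross_apply]

lemma curvature_dotProduct_normal (h : IsNullFrame Z Zb n) :
    curvature Zb Z Z ⬝ᵥ n = -(5 * (Z ⬝ᵥ Zb) * Z 2 * n 2) := by
  have hcross : ∀ c : ℂ, n ⬝ᵥ (Pi.single 2 c) ⨯₃ Z = -I * (c * Z 2) := fun c ↦ by
    rw [triple_product_permutation, ← cross_anticomm, h.cross_left]
    simp
  rw [curvature_eq_cross, h.cross_right_left, dotProduct_comm, map_sub, LinearMap.sub_apply,
    dotProduct_sub, hcross, map_smul, LinearMap.smul_apply, dotProduct_smul, dot_self_cross]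
  simp only [Pi.smul_apply, smul_eq_mul, mul_zero, sub_zero]
  linear_combination 5 * (Z ⬝ᵥ Zb) * Z 2 * n 2 * Complex.I_sq

end IsNullFrame

section Wirtinger

variable {E F G : Type*} [NormedAddCommGroup E] [NormedSpace ℝ E] [NormedSpace ℂ E]
  [NormedAddCommGroup F] [NormedSpace ℝ F] [NormedSpace ℂ F]
  [NormedAddCommGroup G] [NormedSpace ℝ G] [NormedSpace ℂ G]
  {h k : ℂ → E} {c w : ℂ}

/-- The operator `(∂/∂x + c ∂/∂y) / 2`, which is `∂` for `c = -i` and `∂̄` for `c = i`. Keeping `c`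
as a parameter gives the rules for `∂` and `∂̄` at once. -/
def wirtingerDeriv (c : ℂ) (h : ℂ → E) (w : ℂ) : E :=
  (2⁻¹ : ℂ) • (fderiv ℝ h w 1 + c • fderiv ℝ h w I)

lemma wirtinger_eq_wirtingerDeriv : wirtinger = wirtingerDeriv (E := ℂ) (-I) := by
  funext h w
  rw [wirtinger, wirtingerDeriv, smul_eq_mul, smul_eq_mul]
  ring

lemma wirtingerDeriv_of_hasFDerivAt {L : ℂ →L[ℝ] E} (hL : HasFDerivAt h L w) :
    wirtingerDeriv c h w = (2⁻¹ : ℂ) • (L 1 + c • L I) := by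
  rw [wirtingerDeriv, hL.fderiv]

lemma wirtingerDeriv_congr (hhk : h =ᶠ[nhds w] k) :
    wirtingerDeriv c h w = wirtingerDeriv c k w := by
  rw [wirtingerDeriv, wirtingerDeriv, hhk.fderiv_eq]

lemma wirtingerDeriv_const (x : E) : wirtingerDeriv c (fun _ ↦ x) w = 0 := by
  simp [wirtingerDeriv]

lemma wirtingerDeriv_add (hh : DifferentiableAt ℝ h w) (hk : DifferentiableAt ℝ k w) :
    wirtingerDeriv c (fun ζ ↦ h ζ + k ζ) w = wirtingerDeriv c h w + wirtingerDeriv c k w := by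
  simp only [wirtingerDeriv, fderiv_fun_add hh hk, add_apply]
  module

lemma wirtingerDeriv_apply {ι : Type*} [Fintype ι] {h : ℂ → ι → ℂ} (hh : DifferentiableAt ℝ h w)
    (i : ι) : wirtingerDeriv c h w i = wirtingerDeriv c (fun ζ ↦ h ζ i) w := by
  rw [wirtingerDeriv, wirtingerDeriv, fderiv_apply hh]
  rfl

lemma contDiffAt_wirtingerDeriv [IsScalarTower ℝ ℂ E] (hh : ContDiffAt ℝ ∞ h w) :
    ContDiffAt ℝ ∞ (wirtingerDeriv c h) w := by
  have hd : ContDiffAt ℝ ∞ (fderiv ℝ h) w := hh.fderiv_right (by simp)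
  exact ((hd.clm_apply contDiffAt_const).add
    ((hd.clm_apply contDiffAt_const).const_smul c)).const_smul _

lemma wirtingerDeriv_comm [IsScalarTower ℝ ℂ E] (hh : ContDiffAt ℝ 2 h w) (c d : ℂ) :
    wirtingerDeriv c (wirtingerDeriv d h) w = wirtingerDeriv d (wirtingerDeriv c h) w := by
  have hd : HasFDerivAt (fderiv ℝ h) (fderiv ℝ (fderiv ℝ h) w) w :=
    ((hh.fderiv_right (m := 1) le_rfl).differentiableAt one_ne_zero).hasFDerivAt
  have happly (u : ℂ) : HasFDerivAt (fun ζ ↦ fderiv ℝ h ζ u) ((fderiv ℝ (fderiv ℝ h) w).flip u) w :=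
    by simpa using hd.clm_apply (hasFDerivAt_const u w)
  have hexpand (c d : ℂ) := wirtingerDeriv_of_hasFDerivAt (c := c)
    (((happly 1).add ((happly I).const_smul d)).const_smul (2⁻¹ : ℂ))
  have hsymm : fderiv ℝ (fderiv ℝ h) w 1 I = fderiv ℝ (fderiv ℝ h) w I 1 :=
    hh.isSymmSndFDerivAt (by simp) 1 I
  refine (hexpand c d).trans (Eq.trans ?_ (hexpand d c).symm)
  simp only [smul_add, add_apply, smul_apply, ContinuousLinearMap.flip_apply, hsymm]
  module

lemma differentiableAt_of_wirtingerDeriv_eq_zero {h : ℂ → ℂ} (hh : DifferentiableAt ℝ h w)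
    (h0 : wirtingerDeriv I h w = 0) : DifferentiableAt ℂ h w := by
  refine differentiableAt_complex_iff_differentiableAt_real.2 ⟨hh, ?_⟩
  simp only [wirtingerDeriv, smul_eq_mul] at h0 ⊢
  linear_combination (-2 * I) * h0 + fderiv ℝ h w I * Complex.I_sq

section Bilinear

variable [IsScalarTower ℝ ℂ E] [IsScalarTower ℝ ℂ F] [IsScalarTower ℝ ℂ G]
  [FiniteDimensional ℂ E] [FiniteDimensional ℂ F] {u : ℂ → E} {v : ℂ → F}

lemma contDiffAt_bilin (B : E →ₗ[ℂ] F →ₗ[ℂ] G) {n : WithTop ℕ∞} (hu : ContDiffAt ℝ n u w)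
    (hv : ContDiffAt ℝ n v w) : ContDiffAt ℝ n (fun ζ ↦ B (u ζ) (v ζ)) w :=
  (B.toContinuousBilinearMap.bilinearRestrictScalars ℝ).isBoundedBilinearMap.contDiff
    |>.comp_contDiffAt w (hu.prodMk hv)

lemma differentiableAt_bilin (B : E →ₗ[ℂ] F →ₗ[ℂ] G) (hu : DifferentiableAt ℝ u w)
    (hv : DifferentiableAt ℝ v w) : DifferentiableAt ℝ (fun ζ ↦ B (u ζ) (v ζ)) w :=
  ((B.toContinuousBilinearMap.bilinearRestrictScalars ℝ).hasFDerivAt_of_bilinear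
    hu.hasFDerivAt hv.hasFDerivAt).differentiableAt

lemma wirtingerDeriv_bilin (B : E →ₗ[ℂ] F →ₗ[ℂ] G) (hu : DifferentiableAt ℝ u w)
    (hv : DifferentiableAt ℝ v w) :
    wirtingerDeriv c (fun ζ ↦ B (u ζ) (v ζ)) w =
      B (wirtingerDeriv c u w) (v w) + B (u w) (wirtingerDeriv c v w) := by
  have hB := (B.toContinuousBilinearMap.bilinearRestrictScalars ℝ).hasFDerivAt_of_bilinear
    hu.hasFDerivAt hv.hasFDerivAt
  refine (wirtingerDeriv_of_hasFDerivAt hB).trans ?_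
  simp only [ContinuousLinearMap.precompR_apply, ContinuousLinearMap.compL_apply, add_apply,
    ContinuousLinearMap.comp_apply, ContinuousLinearMap.bilinearRestrictScalars_apply_apply,
    LinearMap.toContinuousBilinearMap_apply, ContinuousLinearMap.precompL_apply, smul_add,
    wirtingerDeriv, map_add, map_smul, LinearMap.add_apply, LinearMap.smul_apply]
  module

end Bilinear

lemma wirtingerDeriv_mul {f g : ℂ → ℂ} (hf : DifferentiableAt ℝ f w)
    (hg : DifferentiableAt ℝ g w) :
    wirtingerDeriv c (fun ζ ↦ f ζ * g ζ) w =
      wirtingerDeriv c f w * g w + f w * wirtingerDeriv c g w :=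
  wirtingerDeriv_bilin (LinearMap.mul ℂ ℂ) hf hg

lemma wirtingerDeriv_const_mul (r : ℂ) {f : ℂ → ℂ} (hf : DifferentiableAt ℝ f w) :
    wirtingerDeriv c (fun ζ ↦ r * f ζ) w = r * wirtingerDeriv c f w := by
  rw [wirtingerDeriv_mul (differentiableAt_const r) hf, wirtingerDeriv_const, zero_mul, zero_add]

end Wirtinger

section CovDeriv

variable {u v ζ ξ : ℂ → Fin 3 → ℂ} {c d r w : ℂ}

/-- The covariant derivative, with respect to the operator `wirtingerDeriv c`, of a vector field
along a map into the group, in left invariant coordinates; `ζ` is the `wirtingerDeriv c` of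
the map. -/
def covDeriv (c : ℂ) (ζ v : ℂ → Fin 3 → ℂ) (w : ℂ) : Fin 3 → ℂ :=
  wirtingerDeriv c v w + nabla (ζ w) (v w)

lemma contDiffAt_covDeriv (hζ : ContDiffAt ℝ ∞ ζ w) (hv : ContDiffAt ℝ ∞ v w) :
    ContDiffAt ℝ ∞ (covDeriv c ζ v) w :=
  (contDiffAt_wirtingerDeriv hv).add (contDiffAt_bilin (nablaBilin ℂ) hζ hv)

lemma covDeriv_congr (huv : u =ᶠ[nhds w] v) : covDeriv c ζ u w = covDeriv c ζ v w := by
  rw [covDeriv, covDeriv, wirtingerDeriv_congr huv, huv.eq_of_nhds]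

lemma contDiffAt_dotProduct (hu : ContDiffAt ℝ ∞ u w) (hv : ContDiffAt ℝ ∞ v w) :
    ContDiffAt ℝ ∞ (fun z ↦ u z ⬝ᵥ v z) w :=
  contDiffAt_bilin (dotProductBilin ℂ ℂ) hu hv

lemma wirtingerDeriv_dotProduct (ζ : ℂ → Fin 3 → ℂ) (hu : DifferentiableAt ℝ u w)
    (hv : DifferentiableAt ℝ v w) :
    wirtingerDeriv c (fun z ↦ u z ⬝ᵥ v z) w =
      covDeriv c ζ u w ⬝ᵥ v w + u w ⬝ᵥ covDeriv c ζ v w := by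
  refine (wirtingerDeriv_bilin (dotProductBilin ℂ ℂ) hu hv).trans ?_
  simp only [covDeriv, add_dotProduct, dotProduct_add, nabla_dotProduct_comm (ζ w) (u w),
    dotProductBilin_apply_apply]
  ring

lemma covDeriv_dotProduct_eq_neg (ζ : ℂ → Fin 3 → ℂ) (hu : DifferentiableAt ℝ u w)
    (hv : DifferentiableAt ℝ v w) (huv : ∀ᶠ z in nhds w, u z ⬝ᵥ v z = r) :
    covDeriv c ζ u w ⬝ᵥ v w = -(u w ⬝ᵥ covDeriv c ζ v w) := by
  rw [eq_neg_iff_add_eq_zero, ← wirtingerDeriv_dotProduct ζ hu hv, wirtingerDeriv_congr huv,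
    wirtingerDeriv_const]

lemma covDeriv_dotProduct_self (ζ : ℂ → Fin 3 → ℂ) (hu : DifferentiableAt ℝ u w)
    (huu : ∀ᶠ z in nhds w, u z ⬝ᵥ u z = r) : covDeriv c ζ u w ⬝ᵥ u w = 0 := by
  have := covDeriv_dotProduct_eq_neg (c := c) ζ hu hu huu
  rwa [dotProduct_comm (u w), self_eq_neg] at this

lemma covDeriv_smul {g : ℂ → ℂ} (hg : DifferentiableAt ℝ g w) (hv : DifferentiableAt ℝ v w) :
    covDeriv c ζ (fun z ↦ g z • v z) w = wirtingerDeriv c g w • v w + g w • covDeriv c ζ v w := by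
  have h := wirtingerDeriv_bilin (c := c) (LinearMap.lsmul ℂ (Fin 3 → ℂ)) hg hv
  simp only [LinearMap.lsmul_apply] at h
  rw [covDeriv, h, covDeriv, smul_add, add_assoc]
  exact congrArg _ (congrArg _ ((nablaBilin ℂ (ζ w)).map_smul (g w) (v w)))

lemma covDeriv_const_smul (r : ℂ) (hv : DifferentiableAt ℝ v w) :
    covDeriv c ζ (fun z ↦ r • v z) w = r • covDeriv c ζ v w := by
  rw [covDeriv_smul (differentiableAt_const r) hv, wirtingerDeriv_const, zero_smul, zero_add]

lemma covDeriv_add (hu : DifferentiableAt ℝ u w) (hv : DifferentiableAt ℝ v w) :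
    covDeriv c ζ (fun z ↦ u z + v z) w = covDeriv c ζ u w + covDeriv c ζ v w := by
  rw [covDeriv, wirtingerDeriv_add hu hv, covDeriv, covDeriv, add_add_add_comm]
  exact congrArg _ ((nablaBilin ℂ (ζ w)).map_add (u w) (v w))

lemma covDeriv_comm (hζ : DifferentiableAt ℝ ζ w) (hξ : DifferentiableAt ℝ ξ w)
    (hv : ContDiffAt ℝ ∞ v w) (torsionFree : covDeriv c ζ ξ w = covDeriv d ξ ζ w) :
    covDeriv c ζ (covDeriv d ξ v) w =
      covDeriv d ξ (covDeriv c ζ v) w + curvature (ζ w) (ξ w) (v w) := by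
  have expand {c d : ℂ} {ζ ξ : ℂ → Fin 3 → ℂ} (hξ : DifferentiableAt ℝ ξ w) :
      covDeriv c ζ (covDeriv d ξ v) w = wirtingerDeriv c (wirtingerDeriv d v) w +
        (nabla (wirtingerDeriv c ξ w) (v w) + nabla (ξ w) (wirtingerDeriv c v w)) +
        (nabla (ζ w) (wirtingerDeriv d v w) + nabla (ζ w) (nabla (ξ w) (v w))) := by
    have hv' := hv.differentiableAt (by simp)
    have hdv := (contDiffAt_wirtingerDeriv (c := d) hv).differentiableAt (by simp)
    refine congrArg₂ (· + ·) ((wirtingerDeriv_add hdv ?_).trans (congrArg _ ?_))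
      ((nablaBilin ℂ (ζ w)).map_add _ _)
    · exact differentiableAt_bilin (nablaBilin ℂ) hξ hv'
    · exact wirtingerDeriv_bilin (nablaBilin ℂ) hξ hv'
  have hbracket : wirtingerDeriv d ζ w - wirtingerDeriv c ξ w =
      nabla (ζ w) (ξ w) - nabla (ξ w) (ζ w) := by
    rw [sub_eq_sub_iff_add_eq_add, add_comm (nabla _ _)]
    exact torsionFree.symm
  have hnabla : nabla (wirtingerDeriv d ζ w) (v w) - nabla (wirtingerDeriv c ξ w) (v w) =
      nabla (nabla (ζ w) (ξ w) - nabla (ξ w) (ζ w)) (v w) := by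
    rw [← hbracket]
    exact ((nablaBilin ℂ).map_sub₂ _ _ (v w)).symm
  rw [expand hξ, expand hζ, wirtingerDeriv_comm (hv.of_le ENat.LEInfty.out), curvature]
  linear_combination (exp := 1) -hnabla

end CovDeriv

/-- A field of null frames `Z`, `Zb`, `n` on an open set that satisfies the equations of `f_z`, its
conjugate and the normal for a conformal immersion `f` of constant mean curvature `H`: the symmetry
`∇_z̄ f_z = ∇_z f_z̄`, and the mean curvature equation. -/
structure IsCMCFrame (s : Set ℂ) (Z Zb n : ℂ → Fin 3 → ℂ) (H : ℂ) : Prop where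
  isOpen : IsOpen s
  contDiffAt_left : ∀ w ∈ s, ContDiffAt ℝ ∞ Z w
  contDiffAt_right : ∀ w ∈ s, ContDiffAt ℝ ∞ Zb w
  contDiffAt_normal : ∀ w ∈ s, ContDiffAt ℝ ∞ n w
  isNullFrame : ∀ w ∈ s, IsNullFrame (Z w) (Zb w) (n w)
  torsionFree : ∀ w ∈ s, covDeriv I Zb Z w = covDeriv (-I) Z Zb w
  mean : ∀ w ∈ s, covDeriv I Zb n w ⬝ᵥ Z w + covDeriv (-I) Z n w ⬝ᵥ Zb w =
    -(2 * H * (Z w ⬝ᵥ Zb w))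

namespace IsCMCFrame

variable {s : Set ℂ} {Z Zb n : ℂ → Fin 3 → ℂ} {H w : ℂ}

lemma eventually_isNullFrame (h : IsCMCFrame s Z Zb n H) (hw : w ∈ s) :
    ∀ᶠ z in nhds w, IsNullFrame (Z z) (Zb z) (n z) :=
  (h.isOpen.eventually_mem hw).mono h.isNullFrame

lemma differentiableAt_left (h : IsCMCFrame s Z Zb n H) (hw : w ∈ s) : DifferentiableAt ℝ Z w :=
  (h.contDiffAt_left w hw).differentiableAt (by simp)

lemma differentiableAt_right (h : IsCMCFrame s Z Zb n H) (hw : w ∈ s) : DifferentiableAt ℝ Zb w :=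
  (h.contDiffAt_right w hw).differentiableAt (by simp)

lemma differentiableAt_normal (h : IsCMCFrame s Z Zb n H) (hw : w ∈ s) : DifferentiableAt ℝ n w :=
  (h.contDiffAt_normal w hw).differentiableAt (by simp)

lemma covDeriv_left (h : IsCMCFrame s Z Zb n H) (hw : w ∈ s) :
    covDeriv I Zb Z w = (H * (Z w ⬝ᵥ Zb w)) • n w := by
  have hf := h.isNullFrame w hw
  have hev := h.eventually_isNullFrame hw
  have hZ := h.differentiableAt_left hw
  have hZb := h.differentiableAt_right hw
  have hn := h.differentiableAt_normal hw
  refine hf.ext_dotProduct ?_ ?_ ?_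
  · rw [covDeriv_dotProduct_self Zb hZ (hev.mono fun _ ↦ IsNullFrame.dotProduct_left_self),
      smul_dotProduct, hf.normal_dotProduct_left, smul_zero]
  · rw [h.torsionFree w hw, smul_dotProduct, hf.normal_dotProduct_right, smul_zero,
      covDeriv_dotProduct_self Z hZb (hev.mono fun _ ↦ IsNullFrame.dotProduct_right_self)]
  · have h1 := covDeriv_dotProduct_eq_neg (c := I) Zb hn hZ
      (hev.mono fun _ ↦ IsNullFrame.normal_dotProduct_left)
    have h2 := covDeriv_dotProduct_eq_neg (c := -I) Z hn hZb
      (hev.mono fun _ ↦ IsNullFrame.normal_dotProduct_right)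
    rw [← h.torsionFree w hw] at h2
    rw [smul_dotProduct, hf.normal_dotProduct_self, smul_eq_mul, mul_one, dotProduct_comm]
    linear_combination -(h.mean w hw) / 2 + h1 / 2 + h2 / 2

lemma wirtingerDeriv_left_two (h : IsCMCFrame s Z Zb n H) (hw : w ∈ s) :
    wirtingerDeriv I (fun z ↦ Z z 2) w = (H - I) * (Z w ⬝ᵥ Zb w) * n w 2 := by
  have h2 := congrFun (h.covDeriv_left hw) 2
  rw [covDeriv, Pi.add_apply, (h.isNullFrame w hw).nabla_right_left_two,
    wirtingerDeriv_apply (h.differentiableAt_left hw), Pi.smul_apply, smul_eq_mul] at h2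
  linear_combination h2

lemma covDeriv_covDeriv_dotProduct_normal (h : IsCMCFrame s Z Zb n H) (hw : w ∈ s) :
    covDeriv (-I) Z (covDeriv I Zb Z) w ⬝ᵥ n w = H * (covDeriv (-I) Z Z w ⬝ᵥ Zb w) := by
  have hf := h.isNullFrame w hw
  have hev := h.eventually_isNullFrame hw
  have hZ := h.differentiableAt_left hw
  have hZb := h.differentiableAt_right hw
  have hn := h.differentiableAt_normal hw
  have hconf : DifferentiableAt ℝ (fun z ↦ Z z ⬝ᵥ Zb z) w :=
    (contDiffAt_dotProduct (h.contDiffAt_left w hw) (h.contDiffAt_right w hw)).differentiableAt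
      (by simp)
  have hleft : covDeriv I Zb Z =ᶠ[nhds w] fun z ↦ (H * (Z z ⬝ᵥ Zb z)) • n z :=
    (h.isOpen.eventually_mem hw).mono fun _ ↦ h.covDeriv_left
  rw [covDeriv_congr hleft, covDeriv_smul (hconf.const_mul H) hn, add_dotProduct, smul_dotProduct,
    smul_dotProduct, hf.normal_dotProduct_self, covDeriv_dotProduct_self Z hn
      (hev.mono fun _ ↦ IsNullFrame.normal_dotProduct_self),
    wirtingerDeriv_const_mul H hconf, wirtingerDeriv_dotProduct Z hZ hZb, ← h.torsionFree w hw,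
    h.covDeriv_left hw, dotProduct_smul, dotProduct_comm (Z w) (n w), hf.normal_dotProduct_left]
  simp only [smul_eq_mul, mul_zero, add_zero, mul_one]

lemma covDeriv_dotProduct_covDeriv_normal (h : IsCMCFrame s Z Zb n H) (hw : w ∈ s) :
    covDeriv (-I) Z Z w ⬝ᵥ covDeriv I Zb n w = -(H * (covDeriv (-I) Z Z w ⬝ᵥ Zb w)) := by
  have hf := h.isNullFrame w hw
  have hev := h.eventually_isNullFrame hw
  have hZ := h.differentiableAt_left hw
  have hn := h.differentiableAt_normal hw
  have hiso := hf.mul_dotProduct_of_isotropic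
    (covDeriv_dotProduct_self (c := -I) Z hZ
      (hev.mono fun _ ↦ IsNullFrame.dotProduct_left_self))
    (covDeriv_dotProduct_self (c := I) Zb hn
      (hev.mono fun _ ↦ IsNullFrame.normal_dotProduct_self))
  rw [covDeriv_dotProduct_eq_neg Zb hn hZ (hev.mono fun _ ↦ IsNullFrame.normal_dotProduct_left),
    h.covDeriv_left hw, dotProduct_smul, hf.normal_dotProduct_self, smul_eq_mul] at hiso
  refine mul_left_cancel₀ hf.dotProduct_ne_zero ?_
  linear_combination hiso

lemma wirtingerDeriv_hopf (h : IsCMCFrame s Z Zb n H) (hw : w ∈ s) :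
    wirtingerDeriv I (fun z ↦ covDeriv (-I) Z Z z ⬝ᵥ n z) w =
      -(5 * (Z w ⬝ᵥ Zb w) * Z w 2 * n w 2) := by
  have hZ := h.contDiffAt_left w hw
  rw [wirtingerDeriv_dotProduct Zb ((contDiffAt_covDeriv hZ hZ).differentiableAt (by simp))
      (h.differentiableAt_normal hw),
    covDeriv_comm (h.differentiableAt_right hw) (h.differentiableAt_left hw) hZ
      (h.torsionFree w hw),
    add_dotProduct, h.covDeriv_covDeriv_dotProduct_normal hw,
    h.covDeriv_dotProduct_covDeriv_normal hw, (h.isNullFrame w hw).curvature_dotProduct_normal]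
  ring

theorem differentiableOn (h : IsCMCFrame s Z Zb n H) (hH : H - I ≠ 0) :
    DifferentiableOn ℂ (fun w ↦ covDeriv (-I) Z Z w ⬝ᵥ n w + 5 / (2 * (H - I)) * Z w 2 ^ 2) s := by
  intro w hw
  have hZ := h.contDiffAt_left w hw
  have hZ₃ : DifferentiableAt ℝ (fun z ↦ Z z 2) w :=
    differentiableAt_pi.1 (h.differentiableAt_left hw) 2
  have hhopf : DifferentiableAt ℝ (fun z ↦ covDeriv (-I) Z Z z ⬝ᵥ n z) w :=
    (contDiffAt_dotProduct (contDiffAt_covDeriv hZ hZ) (h.contDiffAt_normal w hw)).differentiableAt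
      (by simp)
  have hcorr : DifferentiableAt ℝ (fun z ↦ 5 / (2 * (H - I)) * Z z 2 ^ 2) w :=
    (hZ₃.pow 2).const_mul _
  refine (differentiableAt_of_wirtingerDeriv_eq_zero (hhopf.add hcorr)
    ?_).differentiableWithinAt
  have hcorr' : wirtingerDeriv I (fun z ↦ 5 / (2 * (H - I)) * Z z 2 ^ 2) w =
      5 * (Z w ⬝ᵥ Zb w) * Z w 2 * n w 2 := by
    simp only [sq]
    rw [wirtingerDeriv_const_mul _ (hZ₃.fun_mul hZ₃), wirtingerDeriv_mul hZ₃ hZ₃,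
      h.wirtingerDeriv_left_two hw]
    field_simp
    ring
  refine (wirtingerDeriv_add hhopf hcorr).trans ?_
  rw [h.wirtingerDeriv_hopf hw, hcorr', neg_add_cancel]

end IsCMCFrame

section MaurerCartan

variable {E : Type*} [NormedAddCommGroup E] [NormedSpace ℝ E] {F : E → ℝ × ℂ} {w : E}

/-- The entry `a` as a function on the chart `(t, b)`. -/
def chartA : ℝ × ℂ → ℂ := a

/-- The map `(g, h) ↦ g⁻¹ h` in the chart `(t, b)`. -/
def chartInvMul : ℝ × ℂ → ℝ × ℂ → ℝ × ℂ := fun g h : SLTilde ↦ g⁻¹ * h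

lemma contDiff_chartA : ContDiff ℝ ∞ chartA := contDiff_a

lemma differentiable_chartA : Differentiable ℝ chartA :=
  contDiff_chartA.differentiable (by simp)

lemma fderiv_chartA_zero (v : ℝ × ℂ) : fderiv ℝ chartA 0 v = v.1 * I := by
  have hline : HasDerivAt (fun t : ℝ ↦ t • v) v 0 := by
    simpa using (hasDerivAt_id (0 : ℝ)).smul_const v
  exact (HasFDerivAt.comp_hasDerivAt_of_eq (0 : ℝ) (differentiable_chartA 0).hasFDerivAt hline
    (by simp)).unique (hasDerivAt_a v)

lemma chartA_mul_conj_sub (g : ℝ × ℂ) :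
    chartA g * conj (chartA g) - g.2 * conj g.2 = 1 := by
  rw [Complex.mul_conj, Complex.mul_conj, sub_eq_iff_eq_add, ← Complex.ofReal_one,
    ← Complex.ofReal_add]
  exact congrArg _ (normSq_a g)

lemma chartA_chartInvMul (g h : ℝ × ℂ) :
    chartA (chartInvMul g h) = conj (chartA g) * chartA h - g.2 * conj h.2 := by
  let g' : SLTilde := g
  have h1 := a_mul g'⁻¹ h
  rw [a_inv, b_inv, neg_mul, ← sub_eq_add_neg] at h1
  exact h1

lemma chartInvMul_snd (g h : ℝ × ℂ) :
    (chartInvMul g h).2 = conj (chartA g) * h.2 - g.2 * conj (chartA h) := by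
  let g' : SLTilde := g
  have h1 := b_mul g'⁻¹ h
  rw [a_inv, b_inv, neg_mul, ← sub_eq_add_neg] at h1
  exact h1

lemma chartInvMul_self (g : ℝ × ℂ) : chartInvMul g g = 0 :=
  inv_mul_cancel (G := SLTilde) g

lemma differentiable_chartInvMul (g : ℝ × ℂ) : Differentiable ℝ (chartInvMul g) := by
  let gInv : ℝ × ℂ := Inv.inv (α := SLTilde) g
  exact (contDiff_mul_aux.differentiable (by simp)).comp
    ((differentiable_const gInv).prodMk differentiable_id)

lemma fderiv_conj_mul_sub_mul_conj {f g h k : E → ℂ} (hf : DifferentiableAt ℝ f w)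
    (hg : DifferentiableAt ℝ g w) (hh : DifferentiableAt ℝ h w) (hk : DifferentiableAt ℝ k w)
    (u : E) :
    fderiv ℝ (fun z ↦ conj (f z) * g z - h z * conj (k z)) w u =
      conj (fderiv ℝ f w u) * g w + conj (f w) * fderiv ℝ g w u -
        (fderiv ℝ h w u * conj (k w) + h w * conj (fderiv ℝ k w u)) := by
  have hderiv := ((Complex.conjCLE.hasFDerivAt.comp w hf.hasFDerivAt).mul hg.hasFDerivAt).sub
    (hh.hasFDerivAt.mul (Complex.conjCLE.hasFDerivAt.comp w hk.hasFDerivAt))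
  refine (congrArg (· u) hderiv.fderiv).trans ?_
  simp only [sub_apply, add_apply, smul_apply, smul_eq_mul, Function.comp_apply,
    ContinuousLinearMap.comp_apply, ContinuousLinearEquiv.coe_coe, ContinuousAlgEquiv.coe_coeCLE,
    ContinuousAlgEquiv.coeCLE_apply, Complex.conjCAE_apply]
  ring

/-- The upper left entry of the matrix valued one-form `F⁻¹ dF`. The lower row of this matrix is
determined by the upper one through conjugation. -/
def maurerCartanDiag (F : E → ℝ × ℂ) (w u : E) : ℂ :=
  conj (chartA (F w)) * fderiv ℝ (fun z ↦ chartA (F z)) w u -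
    (F w).2 * conj (fderiv ℝ (fun z ↦ (F z).2) w u)

/-- The upper right entry of the matrix valued one-form `F⁻¹ dF`. -/
def maurerCartanOffDiag (F : E → ℝ × ℂ) (w u : E) : ℂ :=
  conj (chartA (F w)) * fderiv ℝ (fun z ↦ (F z).2) w u -
    (F w).2 * conj (fderiv ℝ (fun z ↦ chartA (F z)) w u)

lemma differentiableAt_chartA_comp (hF : DifferentiableAt ℝ F w) :
    DifferentiableAt ℝ (fun z ↦ chartA (F z)) w :=
  (differentiable_chartA (F w)).comp w hF

lemma differentiableAt_chartInvMul_comp (hF : DifferentiableAt ℝ F w) :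
    DifferentiableAt ℝ (fun z ↦ chartInvMul (F w) (F z)) w :=
  (differentiable_chartInvMul _ (F w)).comp w hF

lemma fderiv_chartInvMul_comp_fst (hF : DifferentiableAt ℝ F w) (u : E) :
    (fderiv ℝ (fun z ↦ chartInvMul (F w) (F z)) w u).1 * I = maurerCartanDiag F w u := by
  have hchain : fderiv ℝ (fun z ↦ chartA (chartInvMul (F w) (F z))) w u =
      fderiv ℝ chartA 0 (fderiv ℝ (fun z ↦ chartInvMul (F w) (F z)) w u) := by
    rw [← chartInvMul_self (F w)]
    exact congrArg (· u)
      (fderiv_comp w (differentiable_chartA _) (differentiableAt_chartInvMul_comp hF))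
  rw [← fderiv_chartA_zero, ← hchain]
  simp only [chartA_chartInvMul]
  rw [fderiv_conj_mul_sub_mul_conj (differentiableAt_const _) (differentiableAt_chartA_comp hF)
    (differentiableAt_const _) hF.snd]
  simp [maurerCartanDiag]

lemma fderiv_chartInvMul_comp_snd (hF : DifferentiableAt ℝ F w) (u : E) :
    (fderiv ℝ (fun z ↦ chartInvMul (F w) (F z)) w u).2 = maurerCartanOffDiag F w u := by
  have hchain : fderiv ℝ (fun z ↦ (chartInvMul (F w) (F z)).2) w u =
      (fderiv ℝ (fun z ↦ chartInvMul (F w) (F z)) w u).2 :=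
    congrArg (· u) (differentiableAt_chartInvMul_comp hF).hasFDerivAt.snd.fderiv
  rw [← hchain]
  simp only [chartInvMul_snd]
  rw [fderiv_conj_mul_sub_mul_conj (differentiableAt_const _) hF.snd
    (differentiableAt_const _) (differentiableAt_chartA_comp hF)]
  simp [maurerCartanOffDiag]

lemma conj_maurerCartanDiag (hF : DifferentiableAt ℝ F w) (u : E) :
    conj (maurerCartanDiag F w u) = -maurerCartanDiag F w u := by
  rw [← fderiv_chartInvMul_comp_fst hF]
  simp

lemma contDiffAt_chartA_comp (hF : ContDiffAt ℝ ∞ F w) :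
    ContDiffAt ℝ ∞ (fun z ↦ chartA (F z)) w :=
  contDiff_chartA.contDiffAt.comp w hF

lemma contDiffAt_fderiv_apply {G : Type*} [NormedAddCommGroup G] [NormedSpace ℝ G] {h : E → G}
    (hh : ContDiffAt ℝ ∞ h w) (u : E) : ContDiffAt ℝ ∞ (fun z ↦ fderiv ℝ h z u) w :=
  (hh.fderiv_right (m := ∞) (by simp)).clm_apply contDiffAt_const

lemma contDiffAt_conj_mul_sub_mul_conj {f g h k : E → ℂ} (hf : ContDiffAt ℝ ∞ f w)
    (hg : ContDiffAt ℝ ∞ g w) (hh : ContDiffAt ℝ ∞ h w) (hk : ContDiffAt ℝ ∞ k w) :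
    ContDiffAt ℝ ∞ (fun z ↦ conj (f z) * g z - h z * conj (k z)) w :=
  ((Complex.conjCLE.contDiff.contDiffAt.comp w hf).mul hg).sub
    (hh.mul (Complex.conjCLE.contDiff.contDiffAt.comp w hk))

lemma contDiffAt_maurerCartanDiag (hF : ContDiffAt ℝ ∞ F w) (u : E) :
    ContDiffAt ℝ ∞ (fun z ↦ maurerCartanDiag F z u) w :=
  contDiffAt_conj_mul_sub_mul_conj (contDiffAt_chartA_comp hF)
    (contDiffAt_fderiv_apply (contDiffAt_chartA_comp hF) u) hF.snd
    (contDiffAt_fderiv_apply hF.snd u)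

lemma contDiffAt_maurerCartanOffDiag (hF : ContDiffAt ℝ ∞ F w) (u : E) :
    ContDiffAt ℝ ∞ (fun z ↦ maurerCartanOffDiag F z u) w :=
  contDiffAt_conj_mul_sub_mul_conj (contDiffAt_chartA_comp hF)
    (contDiffAt_fderiv_apply hF.snd u) hF.snd
    (contDiffAt_fderiv_apply (contDiffAt_chartA_comp hF) u)

lemma fderiv_fderiv_apply_comm {G : Type*} [NormedAddCommGroup G] [NormedSpace ℝ G] {h : E → G}
    (hh : ContDiffAt ℝ 2 h w) (u v : E) :
    fderiv ℝ (fun z ↦ fderiv ℝ h z v) w u = fderiv ℝ (fun z ↦ fderiv ℝ h z u) w v := by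
  have hd : DifferentiableAt ℝ (fderiv ℝ h) w :=
    (hh.fderiv_right (m := 1) le_rfl).differentiableAt one_ne_zero
  have hexpand (u v : E) : fderiv ℝ (fun z ↦ fderiv ℝ h z v) w u = fderiv ℝ (fderiv ℝ h) w u v := by
    rw [fderiv_clm_apply hd (differentiableAt_const v)]
    simp
  rw [hexpand, hexpand]
  exact hh.isSymmSndFDerivAt (by simp) u v

lemma fderiv_maurerCartanDiag_sub (hF : ContDiffAt ℝ ∞ F w) (u v : E) :
    fderiv ℝ (fun z ↦ maurerCartanDiag F z v) w u - fderiv ℝ (fun z ↦ maurerCartanDiag F z u) w v =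
      maurerCartanOffDiag F w v * conj (maurerCartanOffDiag F w u) -
        maurerCartanOffDiag F w u * conj (maurerCartanOffDiag F w v) := by
  have hA := contDiffAt_chartA_comp hF
  have hB := hF.snd
  have hderiv (u v : E) := fderiv_conj_mul_sub_mul_conj (hA.differentiableAt (by simp))
    ((contDiffAt_fderiv_apply hA v).differentiableAt (by simp)) (hB.differentiableAt (by simp))
    ((contDiffAt_fderiv_apply hB v).differentiableAt (by simp)) u
  have hu := conj_maurerCartanDiag (hF.differentiableAt (by simp)) u
  have hv := conj_maurerCartanDiag (hF.differentiableAt (by simp)) v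
  refine (congrArg₂ (· - ·) (hderiv u v) (hderiv v u)).trans ?_
  rw [fderiv_fderiv_apply_comm (hA.of_le ENat.LEInfty.out) v u,
    fderiv_fderiv_apply_comm (hB.of_le ENat.LEInfty.out) v u]
  have hinv := chartA_mul_conj_sub (F w)
  set α := chartA (F w)
  set β := (F w).2
  set αu := fderiv ℝ (fun z ↦ chartA (F z)) w u
  set αv := fderiv ℝ (fun z ↦ chartA (F z)) w v
  set βu := fderiv ℝ (fun z ↦ (F z).2) w u
  set βv := fderiv ℝ (fun z ↦ (F z).2) w v
  have hprod : conj αu * αv - βu * conj βv - (conj αv * αu - βv * conj βu) =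
      conj (maurerCartanDiag F w u) * maurerCartanDiag F w v -
        conj (maurerCartanDiag F w v) * maurerCartanDiag F w u +
        (maurerCartanOffDiag F w v * conj (maurerCartanOffDiag F w u) -
          maurerCartanOffDiag F w u * conj (maurerCartanOffDiag F w v)) := by
    simp only [maurerCartanDiag, maurerCartanOffDiag, map_sub, map_mul, Complex.conj_conj]
    linear_combination -(conj αu * αv - βu * conj βv - (conj αv * αu - βv * conj βu)) * hinv
  rw [hu, hv] at hprod
  linear_combination hprod

lemma fderiv_maurerCartanOffDiag_sub (hF : ContDiffAt ℝ ∞ F w) (u v : E) :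
    fderiv ℝ (fun z ↦ maurerCartanOffDiag F z v) w u -
        fderiv ℝ (fun z ↦ maurerCartanOffDiag F z u) w v =
      2 * (maurerCartanDiag F w v * maurerCartanOffDiag F w u -
        maurerCartanDiag F w u * maurerCartanOffDiag F w v) := by
  have hA := contDiffAt_chartA_comp hF
  have hB := hF.snd
  have hderiv (u v : E) := fderiv_conj_mul_sub_mul_conj (hA.differentiableAt (by simp))
    ((contDiffAt_fderiv_apply hB v).differentiableAt (by simp)) (hB.differentiableAt (by simp))
    ((contDiffAt_fderiv_apply hA v).differentiableAt (by simp)) u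
  have hu := conj_maurerCartanDiag (hF.differentiableAt (by simp)) u
  have hv := conj_maurerCartanDiag (hF.differentiableAt (by simp)) v
  refine (congrArg₂ (· - ·) (hderiv u v) (hderiv v u)).trans ?_
  rw [fderiv_fderiv_apply_comm (hA.of_le ENat.LEInfty.out) v u,
    fderiv_fderiv_apply_comm (hB.of_le ENat.LEInfty.out) v u]
  have hinv := chartA_mul_conj_sub (F w)
  set α := chartA (F w)
  set β := (F w).2
  set αu := fderiv ℝ (fun z ↦ chartA (F z)) w u
  set αv := fderiv ℝ (fun z ↦ chartA (F z)) w v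
  set βu := fderiv ℝ (fun z ↦ (F z).2) w u
  set βv := fderiv ℝ (fun z ↦ (F z).2) w v
  have hprod : conj αu * βv - βu * conj αv =
      conj (maurerCartanDiag F w u) * maurerCartanOffDiag F w v -
        maurerCartanOffDiag F w u * conj (maurerCartanDiag F w v) := by
    simp only [maurerCartanDiag, maurerCartanOffDiag, map_sub, map_mul, Complex.conj_conj]
    linear_combination -(conj αu * βv - βu * conj αv) * hinv
  rw [hu, hv] at hprod
  linear_combination 2 * hprod

/-- The coordinates in the frame of the element of the Lie algebra whose matrix has the upper row
`p`, `q`. -/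
def frameCoords : ℂ × ℂ →L[ℝ] (Fin 3 → ℝ) :=
  .pi ![(2 : ℝ) • Complex.reCLM.comp (.snd ℝ ℂ ℂ), (2 : ℝ) • Complex.imCLM.comp (.snd ℝ ℂ ℂ),
    (4 : ℝ) • Complex.imCLM.comp (.fst ℝ ℂ ℂ)]

lemma frameCoords_apply (p q : ℂ) : frameCoords (p, q) = ![2 * q.re, 2 * q.im, 4 * p.im] := by
  funext k
  fin_cases k <;> simp [frameCoords]

lemma diffCoords_eq_frameCoords {F : ℂ → ℝ × ℂ} {w : ℂ} (hF : DifferentiableAt ℝ F w) (u : ℂ) :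
    diffCoords F w u = frameCoords (maurerCartanDiag F w u, maurerCartanOffDiag F w u) := by
  have hchain : fderiv ℝ (fun z ↦ chartInvMul (F w) (F z)) w u =
      fderiv ℝ (chartInvMul (F w)) (F w) (fderiv ℝ F w u) :=
    congrArg (· u) (fderiv_comp w (differentiable_chartInvMul _ (F w)) hF)
  have hcoords : diffCoords F w u =
      ⇑(frame.repr (fderiv ℝ (chartInvMul (F w)) (F w) (fderiv ℝ F w u))) :=
    (congrArg (fun T : ℂ →L[ℝ] (ℝ × ℂ) ↦ coords (F w) (T u)) mfderiv_eq_fderiv).trans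
      (congrArg (fun T : (ℝ × ℂ) →L[ℝ] (ℝ × ℂ) ↦ ⇑(frame.repr (T (fderiv ℝ F w u))))
        mfderiv_eq_fderiv)
  rw [hcoords, ← hchain, ← fderiv_chartInvMul_comp_fst hF, ← fderiv_chartInvMul_comp_snd hF,
    frameCoords_apply]
  funext k
  refine (frame_repr_apply _ k).trans ?_
  simp [toPair]

end MaurerCartan

section StructureEquation

variable {F : ℂ → ℝ × ℂ} {w : ℂ}

lemma diffCoords_eventuallyEq_frameCoords (hF : ContDiffAt ℝ ∞ F w) (u : ℂ) :
    (fun z ↦ (diffCoords F z u : Fin 3 → ℝ)) =ᶠ[nhds w]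
      fun z ↦ frameCoords (maurerCartanDiag F z u, maurerCartanOffDiag F z u) := by
  have hdiff : ∀ᶠ z in nhds w, DifferentiableAt ℝ F z :=
    ((hF.of_le (m := 1) ENat.LEInfty.out).eventually (by simp)).mono fun z hz ↦
      hz.differentiableAt one_ne_zero
  exact hdiff.mono fun z hz ↦ diffCoords_eq_frameCoords hz u

lemma contDiffAt_diffCoords (hF : ContDiffAt ℝ ∞ F w) (u : ℂ) :
    ContDiffAt ℝ ∞ (fun z ↦ (diffCoords F z u : Fin 3 → ℝ)) w :=
  have hPQ := (contDiffAt_maurerCartanDiag hF u).prodMk (contDiffAt_maurerCartanOffDiag hF u)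
  (frameCoords.contDiff.contDiffAt.comp w hPQ).congr_of_eventuallyEq
    (diffCoords_eventuallyEq_frameCoords hF u)

lemma fderiv_diffCoords (hF : ContDiffAt ℝ ∞ F w) (u v : ℂ) :
    fderiv ℝ (fun z ↦ (diffCoords F z v : Fin 3 → ℝ)) w u =
      frameCoords (fderiv ℝ (fun z ↦ maurerCartanDiag F z v) w u,
        fderiv ℝ (fun z ↦ maurerCartanOffDiag F z v) w u) := by
  have hP := (contDiffAt_maurerCartanDiag hF v).differentiableAt (by simp)
  have hQ := (contDiffAt_maurerCartanOffDiag hF v).differentiableAt (by simp)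
  rw [(diffCoords_eventuallyEq_frameCoords hF v).fderiv_eq]
  exact congrArg (· u)
    (frameCoords.hasFDerivAt.comp w (hP.hasFDerivAt.prodMk hQ.hasFDerivAt)).fderiv

/-- The covariant derivative, in the direction `u` of the parameter plane, of a vector field `v`
along a map into the group, in left invariant coordinates; `ζ` is the derivative of the map
along `u`. -/
def covDerivAlong (ζ : Fin 3 → ℝ) (v : ℂ → Fin 3 → ℝ) (w u : ℂ) : Fin 3 → ℝ :=
  fderiv ℝ v w u + nabla ζ (v w)

lemma covDerivAlong_diffCoords_comm (hF : ContDiffAt ℝ ∞ F w) (u v : ℂ) :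
    covDerivAlong (diffCoords F w u) (fun z ↦ diffCoords F z v) w u =
      covDerivAlong (diffCoords F w v) (fun z ↦ diffCoords F z u) w v := by
  have hd := hF.differentiableAt (by simp)
  have re_diag (u : ℂ) : (maurerCartanDiag F w u).re = 0 := by
    have h := congrArg Complex.re (conj_maurerCartanDiag hd u)
    rw [Complex.conj_re, Complex.neg_re] at h
    linarith
  have hP := eq_add_of_sub_eq (fderiv_maurerCartanDiag_sub hF u v)
  have hQ := eq_add_of_sub_eq (fderiv_maurerCartanOffDiag_sub hF u v)
  have single_eq (x : ℝ) : (Pi.single 2 x : Fin 3 → ℝ) = ![0, 0, x] := by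
    funext k
    fin_cases k <;> rfl
  rw [covDerivAlong, covDerivAlong, fderiv_diffCoords hF, fderiv_diffCoords hF, hP, hQ,
    diffCoords_eq_frameCoords hd, diffCoords_eq_frameCoords hd, nabla_eq_cross, nabla_eq_cross]
  simp only [frameCoords_apply, single_eq, Complex.add_re, Complex.add_im, Complex.sub_re,
    Complex.sub_im, Complex.mul_re, Complex.mul_im, Complex.conj_re, Complex.conj_im,
    Complex.re_ofNat, Complex.im_ofNat, re_diag]
  funext k
  fin_cases k <;> simp [cross_apply] <;> ring

end StructureEquation

section Complexification

/-- The inclusion of the real vectors into the complex ones. -/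
def ofRealVec : (Fin 3 → ℝ) →L[ℝ] (Fin 3 → ℂ) :=
  .pi fun k ↦ Complex.ofRealCLM.comp (.proj k)

lemma ofRealVec_apply (u : Fin 3 → ℝ) (k : Fin 3) : ofRealVec u k = u k := rfl

lemma ofRealVec_dotProduct (u v : Fin 3 → ℝ) : ofRealVec u ⬝ᵥ ofRealVec v = (u ⬝ᵥ v : ℝ) := by
  simp [dotProduct, ofRealVec_apply]

lemma ofRealVec_cross (u v : Fin 3 → ℝ) :
    ofRealVec u ⨯₃ ofRealVec v = ofRealVec (u ⨯₃ v) := by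
  funext k
  fin_cases k <;> simp [cross_apply, ofRealVec_apply]

lemma nabla_ofRealVec (u v : Fin 3 → ℝ) :
    nabla (ofRealVec u) (ofRealVec v) = ofRealVec (nabla u v) := by
  have hsingle (x : ℝ) : (Pi.single 2 (x : ℂ) : Fin 3 → ℂ) = ofRealVec (Pi.single 2 x) := by
    funext k
    fin_cases k <;> rfl
  rw [nabla_eq_cross, nabla_eq_cross, ← ofRealVec_cross, map_sub ofRealVec, ← hsingle,
    ofRealVec_apply, smul_eq_mul, Complex.ofReal_mul, Complex.real_smul]

/-- Half of `u + c v`. For `c = ∓i` and the derivatives `u`, `v` of a map along the real and the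
imaginary axis these are the derivatives of the map with respect to `z` and `z̄`. -/
def complexify (c : ℂ) (u v : Fin 3 → ℝ) : Fin 3 → ℂ :=
  (2⁻¹ : ℂ) • (ofRealVec u + c • ofRealVec v)

lemma complexify_dotProduct_complexify (c d : ℂ) (u v u' v' : Fin 3 → ℝ) :
    complexify c u v ⬝ᵥ complexify d u' v' =
      ((u ⬝ᵥ u' : ℝ) + d * (u ⬝ᵥ v' : ℝ) + c * (v ⬝ᵥ u' : ℝ) + c * d * (v ⬝ᵥ v' : ℝ)) / 4 := by
  simp only [complexify, ← ofRealVec_dotProduct, smul_dotProduct, dotProduct_smul, add_dotProduct,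
    dotProduct_add, smul_eq_mul]
  ring

variable {X Y U V n : ℂ → Fin 3 → ℝ} {c d w : ℂ}

lemma contDiffAt_ofRealVec (hU : ContDiffAt ℝ ∞ U w) :
    ContDiffAt ℝ ∞ (fun z ↦ ofRealVec (U z)) w :=
  ofRealVec.contDiff.contDiffAt.comp w hU

lemma contDiffAt_complexify (hU : ContDiffAt ℝ ∞ U w) (hV : ContDiffAt ℝ ∞ V w) :
    ContDiffAt ℝ ∞ (fun z ↦ complexify c (U z) (V z)) w :=
  ((contDiffAt_ofRealVec hU).add ((contDiffAt_ofRealVec hV).const_smul c)).const_smul _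

lemma wirtingerDeriv_ofRealVec (hU : DifferentiableAt ℝ U w) :
    wirtingerDeriv c (fun z ↦ ofRealVec (U z)) w =
      complexify c (fderiv ℝ U w 1) (fderiv ℝ U w I) :=
  wirtingerDeriv_of_hasFDerivAt (ofRealVec.hasFDerivAt.comp w hU.hasFDerivAt)

lemma covDeriv_ofRealVec (hU : DifferentiableAt ℝ U w) :
    covDeriv c (fun z ↦ complexify c (X z) (Y z)) (fun z ↦ ofRealVec (U z)) w =
      complexify c (covDerivAlong (X w) U w 1) (covDerivAlong (Y w) U w I) := by
  have hnabla : nabla (complexify c (X w) (Y w)) (ofRealVec (U w)) =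
      complexify c (nabla (X w) (U w)) (nabla (Y w) (U w)) := by
    have h := ((nablaBilin ℂ).flip (ofRealVec (U w))).map_smul 2⁻¹
      (ofRealVec (X w) + c • ofRealVec (Y w))
    rw [map_add, map_smul _ c] at h
    simp only [complexify, ← nabla_ofRealVec]
    exact h
  rw [covDeriv, wirtingerDeriv_ofRealVec hU, hnabla]
  simp only [complexify, covDerivAlong, map_add]
  module

lemma covDeriv_complexify (hU : DifferentiableAt ℝ U w) (hV : DifferentiableAt ℝ V w) :
    covDeriv c (fun z ↦ complexify c (X z) (Y z)) (fun z ↦ complexify d (U z) (V z)) w =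
      (2⁻¹ : ℂ) • (complexify c (covDerivAlong (X w) U w 1) (covDerivAlong (Y w) U w I) +
        d • complexify c (covDerivAlong (X w) V w 1) (covDerivAlong (Y w) V w I)) := by
  have hU' : DifferentiableAt ℝ (fun z ↦ ofRealVec (U z)) w :=
    ofRealVec.differentiableAt.comp w hU
  have hV' : DifferentiableAt ℝ (fun z ↦ ofRealVec (V z)) w :=
    ofRealVec.differentiableAt.comp w hV
  rw [← covDeriv_ofRealVec hU, ← covDeriv_ofRealVec hV, ← covDeriv_const_smul d hV',
    ← covDeriv_add hU' (hV'.fun_const_smul d),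
    ← covDeriv_const_smul _ (hU'.fun_add (hV'.fun_const_smul d))]
  rfl

end Complexification

/-- The configuration of the derivatives `X`, `Y` of an immersion with respect to a positive
conformal parameter and the unit normal `n`. -/
structure IsConformalFrame (X Y n : Fin 3 → ℝ) : Prop where
  dotProduct_self_eq : X ⬝ᵥ X = Y ⬝ᵥ Y
  dotProduct_eq_zero : X ⬝ᵥ Y = 0
  normal_dotProduct_left : n ⬝ᵥ X = 0
  normal_dotProduct_right : n ⬝ᵥ Y = 0
  normal_dotProduct_self : n ⬝ᵥ n = 1
  det_pos : 0 < (Matrix.of ![X, Y, n]).det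

namespace IsConformalFrame

variable {X Y n : Fin 3 → ℝ}

lemma dotProduct_self_pos (h : IsConformalFrame X Y n) : 0 < X ⬝ᵥ X := by
  refine (Finset.sum_nonneg fun i _ ↦ mul_self_nonneg (X i)).lt_of_ne fun h0 ↦ ?_
  have hX : X = 0 := dotProduct_self_eq_zero.1 h0.symm
  exact h.det_pos.ne' (Matrix.det_eq_zero_of_row_eq_zero 0 fun i ↦ congrFun hX i)

lemma cross_left (h : IsConformalFrame X Y n) : n ⨯₃ X = Y := by
  have hpos : 0 < Y ⬝ᵥ n ⨯₃ X := by
    rw [← triple_product_permutation, triple_product_eq_det]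
    exact h.det_pos
  have hnorm : n ⨯₃ X ⬝ᵥ n ⨯₃ X = Y ⬝ᵥ Y := by
    rw [cross_dot_cross, h.normal_dotProduct_self, h.normal_dotProduct_left, h.dotProduct_self_eq]
    ring
  have hparallel : n ⨯₃ X ⨯₃ Y = 0 := by
    rw [cross_cross_eq_smul_sub_smul, h.normal_dotProduct_right, h.dotProduct_eq_zero, zero_smul,
      zero_smul, sub_zero]
  have hsq : (Y ⬝ᵥ n ⨯₃ X) ^ 2 = (Y ⬝ᵥ Y) ^ 2 := by
    have := cross_dot_cross (n ⨯₃ X) Y (n ⨯₃ X) Y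
    rw [hparallel, dotProduct_zero, hnorm, dotProduct_comm (n ⨯₃ X) Y] at this
    linarith
  have hdot : Y ⬝ᵥ n ⨯₃ X = Y ⬝ᵥ Y :=
    (sq_eq_sq₀ hpos.le (Finset.sum_nonneg fun i _ ↦ mul_self_nonneg (Y i))).1 hsq
  rw [← sub_eq_zero, ← dotProduct_self_eq_zero, sub_dotProduct, dotProduct_sub, dotProduct_sub,
    hnorm, dotProduct_comm (n ⨯₃ X) Y, hdot, sub_self]

lemma cross_right (h : IsConformalFrame X Y n) : n ⨯₃ Y = -X := by
  rw [← h.cross_left, cross_cross_eq_smul_sub_smul', h.normal_dotProduct_left,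
    h.normal_dotProduct_self, zero_smul, one_smul, zero_sub]

lemma complexify_dotProduct (h : IsConformalFrame X Y n) :
    complexify (-I) X Y ⬝ᵥ complexify I X Y = ((X ⬝ᵥ X / 2 : ℝ) : ℂ) := by
  rw [complexify_dotProduct_complexify, dotProduct_comm Y X, h.dotProduct_eq_zero,
    ← h.dotProduct_self_eq]
  push_cast
  linear_combination -(X ⬝ᵥ X : ℝ) / 4 * Complex.I_sq

lemma isNullFrame (h : IsConformalFrame X Y n) :
    IsNullFrame (complexify (-I) X Y) (complexify I X Y) (ofRealVec n) where
  cross_left := by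
    simp only [complexify, map_smul, map_add, ofRealVec_cross, h.cross_left, h.cross_right, map_neg]
    ext k
    simp only [Pi.smul_apply, Pi.add_apply, Pi.neg_apply, smul_eq_mul]
    linear_combination (2⁻¹ * ofRealVec Y k) * Complex.I_sq
  cross_right := by
    simp only [complexify, map_smul, map_add, ofRealVec_cross, h.cross_left, h.cross_right, map_neg]
    ext k
    simp only [Pi.smul_apply, Pi.add_apply, Pi.neg_apply, smul_eq_mul]
    linear_combination (2⁻¹ * ofRealVec Y k) * Complex.I_sq
  dotProduct_ne_zero := by
    rw [h.complexify_dotProduct, Complex.ofReal_ne_zero]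
    exact (half_pos h.dotProduct_self_pos).ne'

end IsConformalFrame

lemma isCMCFrame_complexify {X Y n : ℂ → Fin 3 → ℝ} {s : Set ℂ} {H : ℝ} (hs : IsOpen s)
    (hX : ∀ w ∈ s, ContDiffAt ℝ ∞ X w) (hY : ∀ w ∈ s, ContDiffAt ℝ ∞ Y w)
    (hn : ∀ w ∈ s, ContDiffAt ℝ ∞ n w) (hframe : ∀ w ∈ s, IsConformalFrame (X w) (Y w) (n w))
    (torsionFree : ∀ w ∈ s, covDerivAlong (X w) Y w 1 = covDerivAlong (Y w) X w I)
    (mean : ∀ w ∈ s, covDerivAlong (X w) n w 1 ⬝ᵥ X w + covDerivAlong (Y w) n w I ⬝ᵥ Y w =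
      -(2 * H * (X w ⬝ᵥ X w))) :
    IsCMCFrame s (fun w ↦ complexify (-I) (X w) (Y w)) (fun w ↦ complexify I (X w) (Y w))
      (fun w ↦ ofRealVec (n w)) H where
  isOpen := hs
  contDiffAt_left w hw := contDiffAt_complexify (hX w hw) (hY w hw)
  contDiffAt_right w hw := contDiffAt_complexify (hX w hw) (hY w hw)
  contDiffAt_normal w hw := contDiffAt_ofRealVec (hn w hw)
  isNullFrame w hw := (hframe w hw).isNullFrame
  torsionFree w hw := by
    have hX' := (hX w hw).differentiableAt (by simp)
    have hY' := (hY w hw).differentiableAt (by simp)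
    rw [covDeriv_complexify hX' hY', covDeriv_complexify hX' hY', torsionFree w hw]
    simp only [complexify]
    module
  mean w hw := by
    have hn' := (hn w hw).differentiableAt (by simp)
    rw [covDeriv_ofRealVec hn', covDeriv_ofRealVec hn', (hframe w hw).complexify_dotProduct,
      complexify_dotProduct_complexify, complexify_dotProduct_complexify]
    have hmean := congrArg Complex.ofReal (mean w hw)
    push_cast at hmean ⊢
    linear_combination hmean / 2 - (covDerivAlong (Y w) n w I ⬝ᵥ Y w : ℝ) / 2 * Complex.I_sq

section LocalParameter

variable {M : Type*} [TopologicalSpace M] {f : M → SLTilde}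
  {N : ∀ p, TangentSpace 𝓘(ℝ, ℝ × ℂ) (f p)} {φ : OpenPartialHomeomorph M ℂ}
  {H : ℝ} {p : M} {w : ℂ}

/-- The surface in a local parameter, as a map into the chart `(t, b)` of the group. -/
def localMap (f : M → SLTilde) (φ : OpenPartialHomeomorph M ℂ) : ℂ → ℝ × ℂ := f ∘ φ.symm

/-- The left invariant coordinates of the normal in a local parameter. -/
def localNormal (f : M → SLTilde) (N : ∀ p, TangentSpace 𝓘(ℝ, ℝ × ℂ) (f p))
    (φ : OpenPartialHomeomorph M ℂ) (w : ℂ) : Fin 3 → ℝ := normalCoords f N (φ.symm w)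

lemma Z_eq_complexify (f : M → SLTilde) (φ : OpenPartialHomeomorph M ℂ) (w : ℂ) :
    Z f φ w = complexify (-I) (partialX f φ w) (partialY f φ w) := by
  funext k
  simp only [Z, complexify, Pi.smul_apply, Pi.add_apply, smul_eq_mul, ofRealVec_apply]
  ring

lemma hopfCoeff_eq_covDeriv (hZ : DifferentiableAt ℝ (Z f φ) w) :
    hopfCoeff f N φ w = covDeriv (-I) (Z f φ) (Z f φ) w ⬝ᵥ ofRealVec (localNormal f N φ w) := by
  simp only [hopfCoeff, covDeriv, dotProduct, Pi.add_apply, wirtingerDeriv_apply hZ,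
    wirtinger_eq_wirtingerDeriv, ofRealVec_apply, localNormal]

variable [ChartedSpace ℂ M]

/-- The derivative of the inverse of a local parameter, as an endomorphism of the model space of the
tangent spaces. -/
def symmDeriv (φ : OpenPartialHomeomorph M ℂ) (w : ℂ) : ℂ →L[ℝ] ℂ :=
  mfderiv 𝓘(ℝ, ℂ) 𝓘(ℝ, ℂ) φ.symm w

/-- The pull-back of a vector valued one-form on the surface to the parameter plane. -/
def chartPullback (α : M → ℂ →ₗ[ℝ] (Fin 3 → ℝ)) (φ : OpenPartialHomeomorph M ℂ) (w : ℂ) :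
    ℂ →ₗ[ℝ] (Fin 3 → ℝ) :=
  α (φ.symm w) ∘ₗ (symmDeriv φ w).toLinearMap

/-- The left translation of a tangent vector to the unit, in coordinates, as a linear map. -/
def coordsLin (g : SLTilde) : ℝ × ℂ →ₗ[ℝ] (Fin 3 → ℝ) :=
  let toFun : LieAlg →ₗ[ℝ] (Fin 3 → ℝ) := Finsupp.lcoeFun ∘ₗ frame.repr.toLinearMap
  let translation : ℝ × ℂ →L[ℝ] LieAlg := mfderiv 𝓘(ℝ, ℝ × ℂ) 𝓘(ℝ, ℝ × ℂ) (fun h ↦ g⁻¹ * h) g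
  toFun ∘ₗ translation.toLinearMap

/-- The one-form `f⁻¹ df`. -/
def diffCoordsLin (f : M → SLTilde) (p : M) : ℂ →ₗ[ℝ] (Fin 3 → ℝ) :=
  let df : ℂ →L[ℝ] ℝ × ℂ := mfderiv 𝓘(ℝ, ℂ) 𝓘(ℝ, ℝ × ℂ) f p
  coordsLin (f p) ∘ₗ df.toLinearMap

/-- The one-form `f⁻¹ ∇N`. -/
def covDerivNormalLin (f : M → SLTilde) (N : ∀ p, TangentSpace 𝓘(ℝ, ℝ × ℂ) (f p)) (p : M) :
    ℂ →ₗ[ℝ] (Fin 3 → ℝ) :=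
  let dN : ℂ →L[ℝ] (Fin 3 → ℝ) := mfderiv 𝓘(ℝ, ℂ) 𝓘(ℝ, Fin 3 → ℝ) (normalCoords f N) p
  dN.toLinearMap + (nablaBilin ℝ).flip (normalCoords f N p) ∘ₗ diffCoordsLin f p

lemma HasMeanCurvatureAt.dotProduct_add_dotProduct (hH : HasMeanCurvatureAt f N H p) {u v : ℂ}
    (hpos : 0 < diffCoordsLin f p u ⬝ᵥ diffCoordsLin f p u)
    (heq : diffCoordsLin f p u ⬝ᵥ diffCoordsLin f p u =
      diffCoordsLin f p v ⬝ᵥ diffCoordsLin f p v)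
    (horth : diffCoordsLin f p u ⬝ᵥ diffCoordsLin f p v = 0) :
    covDerivNormalLin f N p u ⬝ᵥ diffCoordsLin f p u +
      covDerivNormalLin f N p v ⬝ᵥ diffCoordsLin f p v =
        -(2 * H * (diffCoordsLin f p u ⬝ᵥ diffCoordsLin f p u)) := by
  set r := (√(diffCoordsLin f p u ⬝ᵥ diffCoordsLin f p u))⁻¹ with hr
  have hmetric (x y : ℂ) : inducedMetric f p (r • x) (r • y) =
      r ^ 2 * (diffCoordsLin f p x ⬝ᵥ diffCoordsLin f p y) := by
    change diffCoordsLin f p (r • x) ⬝ᵥ diffCoordsLin f p (r • y) = _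
    rw [map_smul, map_smul, smul_dotProduct, dotProduct_smul, smul_smul, ← sq, smul_eq_mul]
  have hsecond (x : ℂ) : secondFundamentalForm f N p (r • x) (r • x) =
      -(r ^ 2 * (covDerivNormalLin f N p x ⬝ᵥ diffCoordsLin f p x)) := by
    change -(covDerivNormalLin f N p (r • x) ⬝ᵥ diffCoordsLin f p (r • x)) = _
    rw [map_smul, map_smul, smul_dotProduct, dotProduct_smul, smul_smul, ← sq, smul_eq_mul]
  have hunit : r ^ 2 * (diffCoordsLin f p u ⬝ᵥ diffCoordsLin f p u) = 1 := by
    rw [hr, inv_pow, Real.sq_sqrt hpos.le, inv_mul_cancel₀ hpos.ne']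
  have htrace := hH (r • u) (r • v) ((hmetric u u).trans hunit)
    ((hmetric v v).trans (heq ▸ hunit)) (by rw [hmetric, horth, mul_zero])
  rw [hsecond, hsecond] at htrace
  linear_combination (2 * (diffCoordsLin f p u ⬝ᵥ diffCoordsLin f p u)) * htrace -
    (covDerivNormalLin f N p u ⬝ᵥ diffCoordsLin f p u +
      covDerivNormalLin f N p v ⬝ᵥ diffCoordsLin f p v) * hunit

section MaximalAtlas

variable (hφ : φ ∈ IsManifold.maximalAtlas 𝓘(ℝ, ℂ) ∞ M) (hw : w ∈ φ.target)
include hφ hw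

lemma mdifferentiableAt_symm : MDifferentiableAt 𝓘(ℝ, ℂ) 𝓘(ℝ, ℂ) φ.symm w :=
  ((contMDiffOn_symm_of_mem_maximalAtlas hφ).contMDiffAt
    (φ.open_target.mem_nhds hw)).mdifferentiableAt (by simp)

lemma contDiffAt_localMap (hf : ContMDiff 𝓘(ℝ, ℂ) 𝓘(ℝ, ℝ × ℂ) ∞ f) :
    ContDiffAt ℝ ∞ (localMap f φ) w :=
  contMDiffAt_iff_contDiffAt.1 <| hf.contMDiffAt.comp w <|
    (contMDiffOn_symm_of_mem_maximalAtlas hφ).contMDiffAt (φ.open_target.mem_nhds hw)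

lemma contDiffAt_localNormal (hN : IsUnitNormalField f N) :
    ContDiffAt ℝ ∞ (localNormal f N φ) w :=
  contMDiffAt_iff_contDiffAt.1 <| hN.smooth.contMDiffAt.comp w <|
    (contMDiffOn_symm_of_mem_maximalAtlas hφ).contMDiffAt (φ.open_target.mem_nhds hw)

lemma diffCoords_localMap (hf : ContMDiff 𝓘(ℝ, ℂ) 𝓘(ℝ, ℝ × ℂ) ∞ f) (u : ℂ) :
    diffCoords (localMap f φ) w u = chartPullback (diffCoordsLin f) φ w u := by
  have hchain : mfderiv 𝓘(ℝ, ℂ) 𝓘(ℝ, ℝ × ℂ) (f ∘ φ.symm) w =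
      (mfderiv 𝓘(ℝ, ℂ) 𝓘(ℝ, ℝ × ℂ) f (φ.symm w)).comp (mfderiv 𝓘(ℝ, ℂ) 𝓘(ℝ, ℂ) φ.symm w) :=
    mfderiv_comp w (hf.mdifferentiableAt (by simp)) (mdifferentiableAt_symm hφ hw)
  exact congrArg (fun L : ℂ →L[ℝ] ℝ × ℂ ↦ coords (f (φ.symm w)) (L u)) hchain

lemma partialX_eq_chartPullback (hf : ContMDiff 𝓘(ℝ, ℂ) 𝓘(ℝ, ℝ × ℂ) ∞ f) :
    partialX f φ w = chartPullback (diffCoordsLin f) φ w 1 := diffCoords_localMap hφ hw hf 1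

lemma partialY_eq_chartPullback (hf : ContMDiff 𝓘(ℝ, ℂ) 𝓘(ℝ, ℝ × ℂ) ∞ f) :
    partialY f φ w = chartPullback (diffCoordsLin f) φ w I := diffCoords_localMap hφ hw hf I

lemma covDerivAlong_localNormal (hf : ContMDiff 𝓘(ℝ, ℂ) 𝓘(ℝ, ℝ × ℂ) ∞ f)
    (hN : IsUnitNormalField f N) (u : ℂ) :
    covDerivAlong (diffCoords (localMap f φ) w u) (localNormal f N φ) w u =
      chartPullback (covDerivNormalLin f N) φ w u := by
  have hchain := mfderiv_comp w (hN.smooth.mdifferentiableAt (x := φ.symm w) (by simp))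
    (mdifferentiableAt_symm hφ hw)
  have hfderiv : (mfderiv 𝓘(ℝ, ℂ) 𝓘(ℝ, Fin 3 → ℝ) (normalCoords f N ∘ φ.symm) w :
      ℂ →L[ℝ] Fin 3 → ℝ) = fderiv ℝ (localNormal f N φ) w := mfderiv_eq_fderiv
  rw [covDerivAlong, diffCoords_localMap hφ hw hf, ← hfderiv]
  exact congrArg (fun L : ℂ →L[ℝ] (Fin 3 → ℝ) ↦ L u + nabla (chartPullback (diffCoordsLin f) φ w u)
    (localNormal f N φ w)) hchain

end MaximalAtlas

namespace IsConformalParameter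

variable (hφ : IsConformalParameter f N φ) (hw : w ∈ φ.target)
include hφ hw

lemma isConformalFrame (hf : ContMDiff 𝓘(ℝ, ℂ) 𝓘(ℝ, ℝ × ℂ) ∞ f) (hN : IsUnitNormalField f N) :
    IsConformalFrame (partialX f φ w) (partialY f φ w) (localNormal f N φ w) where
  dotProduct_self_eq := (hφ.conformal w hw).1
  dotProduct_eq_zero := (hφ.conformal w hw).2
  normal_dotProduct_left :=
    (congrArg _ (partialX_eq_chartPullback hφ.mem_maximalAtlas hw hf)).trans (hN.orthogonal _ _)
  normal_dotProduct_right :=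
    (congrArg _ (partialY_eq_chartPullback hφ.mem_maximalAtlas hw hf)).trans (hN.orthogonal _ _)
  normal_dotProduct_self := hN.unit _
  det_pos := hφ.positive w hw

lemma mean_curvature (hf : ContMDiff 𝓘(ℝ, ℂ) 𝓘(ℝ, ℝ × ℂ) ∞ f) (hN : IsUnitNormalField f N)
    (hH : HasMeanCurvatureAt f N H (φ.symm w)) :
    covDerivAlong (partialX f φ w) (localNormal f N φ) w 1 ⬝ᵥ partialX f φ w +
      covDerivAlong (partialY f φ w) (localNormal f N φ) w I ⬝ᵥ partialY f φ w =
        -(2 * H * (partialX f φ w ⬝ᵥ partialX f φ w)) := by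
  have hframe := hφ.isConformalFrame hw hf hN
  have hpos := hframe.dotProduct_self_pos
  have heq := hframe.dotProduct_self_eq
  have horth := hframe.dotProduct_eq_zero
  have hX : partialX f φ w = _ := partialX_eq_chartPullback hφ.mem_maximalAtlas hw hf
  have hY : partialY f φ w = _ := partialY_eq_chartPullback hφ.mem_maximalAtlas hw hf
  have hnX : covDerivAlong (partialX f φ w) (localNormal f N φ) w 1 = _ :=
    covDerivAlong_localNormal hφ.mem_maximalAtlas hw hf hN 1
  have hnY : covDerivAlong (partialY f φ w) (localNormal f N φ) w I = _ :=
    covDerivAlong_localNormal hφ.mem_maximalAtlas hw hf hN I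
  rw [hnX, hnY]
  rw [hX] at hpos heq horth ⊢
  rw [hY] at heq horth ⊢
  exact hH.dotProduct_add_dotProduct hpos heq horth

end IsConformalParameter

lemma IsConformalParameter.isCMCFrame (hφ : IsConformalParameter f N φ)
    (hf : ContMDiff 𝓘(ℝ, ℂ) 𝓘(ℝ, ℝ × ℂ) ∞ f) (hN : IsUnitNormalField f N)
    (hH : ∀ p, HasMeanCurvatureAt f N H p) :
    IsCMCFrame φ.target (Z f φ) (fun w ↦ complexify I (partialX f φ w) (partialY f φ w))
      (fun w ↦ ofRealVec (localNormal f N φ w)) H := by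
  rw [funext (Z_eq_complexify f φ)]
  have hF (w : ℂ) (hw : w ∈ φ.target) := contDiffAt_localMap hφ.mem_maximalAtlas hw hf
  exact isCMCFrame_complexify φ.open_target (fun w hw ↦ contDiffAt_diffCoords (hF w hw) 1)
    (fun w hw ↦ contDiffAt_diffCoords (hF w hw) I)
    (fun w hw ↦ contDiffAt_localNormal hφ.mem_maximalAtlas hw hN)
    (fun w hw ↦ hφ.isConformalFrame hw hf hN)
    (fun w hw ↦ covDerivAlong_diffCoords_comm (hF w hw) 1 I)
    (fun w hw ↦ hφ.mean_curvature hw hf hN (hH _))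

lemma differentiableOn_abreschCoeff (hφ : IsConformalParameter f N φ)
    (hf : ContMDiff 𝓘(ℝ, ℂ) 𝓘(ℝ, ℝ × ℂ) ∞ f) (hN : IsUnitNormalField f N)
    (hH : ∀ p, HasMeanCurvatureAt f N H p) :
    DifferentiableOn ℂ (abreschCoeff f N H φ) φ.target := by
  have hframe := hφ.isCMCFrame hf hN hH
  have hne : (H : ℂ) - I ≠ 0 := fun h ↦ by simpa using congrArg Complex.im h
  refine (hframe.differentiableOn hne).congr fun w hw ↦ ?_
  rw [abreschCoeff,
    hopfCoeff_eq_covDeriv ((hframe.contDiffAt_left w hw).differentiableAt (by simp))]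

end LocalParameter

section Transformation

lemma linearMap_apply_eq_smul_add_smul {V : Type*} [AddCommGroup V] [Module ℝ V] (L : ℂ →ₗ[ℝ] V)
    (z : ℂ) : L z = z.re • L 1 + z.im • L I := by
  rw [← map_smul, ← map_smul, ← map_add]
  congr 1
  apply Complex.ext <;> simp

lemma complexify_mul_left (L : ℂ →ₗ[ℝ] Fin 3 → ℝ) (c : ℂ) :
    complexify (-I) (L c) (L (I * c)) = c • complexify (-I) (L 1) (L I) := by
  rw [linearMap_apply_eq_smul_add_smul L c, linearMap_apply_eq_smul_add_smul L (I * c)]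
  funext k
  simp only [complexify, map_add, Pi.smul_apply, Pi.add_apply, ofRealVec_apply, smul_eq_mul,
    Complex.I_mul_re, Complex.I_mul_im, Complex.ofReal_mul, Complex.ofReal_neg]
  linear_combination (2⁻¹ * (L 1 k - I * L I k) : ℂ) * Complex.re_add_im c +
    (2⁻¹ * c.im * L I k : ℂ) * Complex.I_sq

section ConformalFrame

variable {L : ℂ →ₗ[ℝ] Fin 3 → ℝ} {n : Fin 3 → ℝ} {a b z : ℂ}

lemma IsConformalFrame.cross_apply (h : IsConformalFrame (L 1) (L I) n) :
    n ⨯₃ L z = L (I * z) := by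
  rw [linearMap_apply_eq_smul_add_smul L z, linearMap_apply_eq_smul_add_smul L (I * z), map_add,
    map_smul, map_smul, h.cross_left, h.cross_right, Complex.I_mul_re, Complex.I_mul_im]
  module

lemma IsConformalFrame.injective (h : IsConformalFrame (L 1) (L I) n) : Function.Injective L := by
  refine (injective_iff_map_eq_zero L).2 fun z hz ↦ ?_
  rw [linearMap_apply_eq_smul_add_smul] at hz
  have hre := congrArg (L 1 ⬝ᵥ ·) hz
  have him := congrArg (L I ⬝ᵥ ·) hz
  simp only [dotProduct_add, dotProduct_smul, dotProduct_comm (L I) (L 1), h.dotProduct_eq_zero,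
    ← h.dotProduct_self_eq, smul_eq_mul, dotProduct_zero, mul_zero, add_zero, zero_add, mul_eq_zero,
    h.dotProduct_self_pos.ne', or_false] at hre him
  exact Complex.ext hre him

lemma IsConformalFrame.eq_I_mul (h : IsConformalFrame (L 1) (L I) n)
    (hab : IsConformalFrame (L a) (L b) n) : b = I * a :=
  h.injective <| hab.cross_left.symm.trans h.cross_apply

end ConformalFrame

variable {M : Type*} [TopologicalSpace M] {φ ψ : OpenPartialHomeomorph M ℂ} {p : M}

lemma eventually_symm_eq (hp : p ∈ φ.source ∩ ψ.source) :
    φ.symm =ᶠ[nhds (φ p)] ψ.symm ∘ ψ ∘ φ.symm := by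
  have hsymm := φ.symm.continuousAt (φ.map_source hp.1)
  rw [ContinuousAt, φ.left_inv hp.1] at hsymm
  filter_upwards [hsymm.eventually (ψ.open_source.mem_nhds hp.2)] with ζ hζ
  exact (ψ.left_inv hζ).symm

variable [ChartedSpace ℂ M] {f : M → SLTilde} {N : ∀ p, TangentSpace 𝓘(ℝ, ℝ × ℂ) (f p)}

section MaximalAtlas

variable (hφ : φ ∈ IsManifold.maximalAtlas 𝓘(ℝ, ℂ) ∞ M)
  (hψ : ψ ∈ IsManifold.maximalAtlas 𝓘(ℝ, ℂ) ∞ M) (hp : p ∈ φ.source ∩ ψ.source)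
include hφ hψ hp

lemma differentiableAt_transition : DifferentiableAt ℝ (ψ ∘ φ.symm) (φ p) := by
  rw [← mdifferentiableAt_iff_differentiableAt]
  have hψ' : MDifferentiableAt 𝓘(ℝ, ℂ) 𝓘(ℝ, ℂ) ψ (φ.symm (φ p)) := by
    rw [φ.left_inv hp.1]
    exact (contMDiffAt_of_mem_maximalAtlas hψ hp.2).mdifferentiableAt (by simp)
  exact hψ'.comp (φ p) (mdifferentiableAt_symm hφ (φ.map_source hp.1))

lemma symmDeriv_eq_comp :
    symmDeriv φ (φ p) = symmDeriv ψ (ψ p) ∘L fderiv ℝ (ψ ∘ φ.symm) (φ p) := by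
  have hψp : (ψ ∘ φ.symm) (φ p) = ψ p := congrArg ψ (φ.left_inv hp.1)
  have hψ' : MDifferentiableAt 𝓘(ℝ, ℂ) 𝓘(ℝ, ℂ) ψ.symm ((ψ ∘ φ.symm) (φ p)) := by
    rw [hψp]
    exact mdifferentiableAt_symm hψ (ψ.map_source hp.2)
  have hchain : symmDeriv φ (φ p) = symmDeriv ψ ((ψ ∘ φ.symm) (φ p)) ∘L
      mfderiv 𝓘(ℝ, ℂ) 𝓘(ℝ, ℂ) (ψ ∘ φ.symm) (φ p) :=
    (eventually_symm_eq hp).mfderiv_eq.trans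
      (mfderiv_comp (φ p) hψ' (differentiableAt_transition hφ hψ hp).mdifferentiableAt)
  rw [hchain, hψp, mfderiv_eq_fderiv]
  rfl

lemma chartPullback_eq_comp (α : M → ℂ →ₗ[ℝ] (Fin 3 → ℝ)) : chartPullback α φ (φ p) =
    chartPullback α ψ (ψ p) ∘ₗ (fderiv ℝ (ψ ∘ φ.symm) (φ p)).toLinearMap := by
  rw [chartPullback, chartPullback, φ.left_inv hp.1, ψ.left_inv hp.2,
    symmDeriv_eq_comp hφ hψ hp]
  rfl

end MaximalAtlas

namespace IsConformalParameter

variable (hφ : IsConformalParameter f N φ) (hψ : IsConformalParameter f N ψ)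
  (hf : ContMDiff 𝓘(ℝ, ℂ) 𝓘(ℝ, ℝ × ℂ) ∞ f) (hN : IsUnitNormalField f N)
include hφ hf hN

lemma isConformalFrame_chartPullback {w : ℂ} (hw : w ∈ φ.target) :
    IsConformalFrame (chartPullback (diffCoordsLin f) φ w 1)
      (chartPullback (diffCoordsLin f) φ w I) (normalCoords f N (φ.symm w)) := by
  rw [← partialX_eq_chartPullback hφ.mem_maximalAtlas hw hf,
    ← partialY_eq_chartPullback hφ.mem_maximalAtlas hw hf]
  exact hφ.isConformalFrame hw hf hN

lemma hopfCoeff_eq_neg_dotProduct {w : ℂ} (hw : w ∈ φ.target) : hopfCoeff f N φ w =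
    -(complexify (-I) (chartPullback (covDerivNormalLin f N) φ w 1)
      (chartPullback (covDerivNormalLin f N) φ w I) ⬝ᵥ Z f φ w) := by
  have hX (u : ℂ) := contDiffAt_diffCoords (contDiffAt_localMap hφ.mem_maximalAtlas hw hf) u
  have hZ : DifferentiableAt ℝ (Z f φ) w := by
    rw [funext (Z_eq_complexify f φ)]
    exact (contDiffAt_complexify (hX 1) (hX I)).differentiableAt (by simp)
  have hn := (contDiffAt_localNormal hφ.mem_maximalAtlas hw hN).differentiableAt (by simp)
  have hn' : DifferentiableAt ℝ (fun z ↦ ofRealVec (localNormal f N φ z)) w :=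
    ofRealVec.differentiableAt.comp w hn
  have horth : ∀ᶠ z in nhds w, Z f φ z ⬝ᵥ ofRealVec (localNormal f N φ z) = 0 := by
    filter_upwards [φ.open_target.mem_nhds hw] with z hz
    rw [Z_eq_complexify, dotProduct_comm]
    exact (hφ.isConformalFrame hz hf hN).isNullFrame.normal_dotProduct_left
  rw [hopfCoeff_eq_covDeriv hZ, covDeriv_dotProduct_eq_neg _ hZ hn' horth, dotProduct_comm,
    ← covDerivAlong_localNormal hφ.mem_maximalAtlas hw hf hN,
    ← covDerivAlong_localNormal hφ.mem_maximalAtlas hw hf hN, funext (Z_eq_complexify f φ),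
    covDeriv_ofRealVec hn]
  rfl

include hψ

lemma fderiv_transition_I (hp : p ∈ φ.source ∩ ψ.source) :
    fderiv ℝ (ψ ∘ φ.symm) (φ p) I = I * fderiv ℝ (ψ ∘ φ.symm) (φ p) 1 := by
  have hframeφ := hφ.isConformalFrame_chartPullback hf hN (φ.map_source hp.1)
  have hframeψ := hψ.isConformalFrame_chartPullback hf hN (ψ.map_source hp.2)
  rw [chartPullback_eq_comp hφ.mem_maximalAtlas hψ.mem_maximalAtlas hp, φ.left_inv hp.1] at hframeφ
  rw [ψ.left_inv hp.2] at hframeψ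
  exact hframeψ.eq_I_mul hframeφ

lemma hasDerivAt_transition (hp : p ∈ φ.source ∩ ψ.source) :
    HasDerivAt (ψ ∘ φ.symm) (fderiv ℝ (ψ ∘ φ.symm) (φ p) 1) (φ p) :=
  complexOfReal_hasDerivAt
    (differentiableAt_transition hφ.mem_maximalAtlas hψ.mem_maximalAtlas hp)
    (hφ.fderiv_transition_I hψ hf hN hp)

lemma complexify_chartPullback (α : M → ℂ →ₗ[ℝ] (Fin 3 → ℝ)) (hp : p ∈ φ.source ∩ ψ.source) :
    complexify (-I) (chartPullback α φ (φ p) 1) (chartPullback α φ (φ p) I) =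
      fderiv ℝ (ψ ∘ φ.symm) (φ p) 1 •
        complexify (-I) (chartPullback α ψ (ψ p) 1) (chartPullback α ψ (ψ p) I) := by
  rw [← complexify_mul_left, ← hφ.fderiv_transition_I hψ hf hN hp,
    chartPullback_eq_comp hφ.mem_maximalAtlas hψ.mem_maximalAtlas hp]
  rfl

lemma abreschCoeff_transition (H : ℝ) (hp : p ∈ φ.source ∩ ψ.source) :
    abreschCoeff f N H φ (φ p) =
      abreschCoeff f N H ψ (ψ p) * fderiv ℝ (ψ ∘ φ.symm) (φ p) 1 ^ 2 := by
  have hw := φ.map_source hp.1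
  have hw' := ψ.map_source hp.2
  have hZ : Z f φ (φ p) = fderiv ℝ (ψ ∘ φ.symm) (φ p) 1 • Z f ψ (ψ p) := by
    rw [Z_eq_complexify, Z_eq_complexify, partialX_eq_chartPullback hφ.mem_maximalAtlas hw hf,
      partialY_eq_chartPullback hφ.mem_maximalAtlas hw hf,
      partialX_eq_chartPullback hψ.mem_maximalAtlas hw' hf,
      partialY_eq_chartPullback hψ.mem_maximalAtlas hw' hf,
      hφ.complexify_chartPullback hψ hf hN _ hp]
  rw [abreschCoeff, abreschCoeff, hφ.hopfCoeff_eq_neg_dotProduct hf hN hw,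
    hψ.hopfCoeff_eq_neg_dotProduct hf hN hw', hφ.complexify_chartPullback hψ hf hN _ hp, hZ]
  simp only [smul_dotProduct, dotProduct_smul, smul_eq_mul, Pi.smul_apply]
  ring

end IsConformalParameter

end Transformation

end SLTilde

end

theorem mainTheorem5 {M : Type*} [TopologicalSpace M] [ChartedSpace ℂ M]
    [IsManifold 𝓘(ℝ, ℂ) ∞ M] (f : M → SLTilde) (hf : SLTilde.IsSmoothImmersion f)
    (N : ∀ p, TangentSpace 𝓘(ℝ, ℝ × ℂ) (f p)) (hN : SLTilde.IsUnitNormalField f N)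
    (H : ℝ) (hH : ∀ p, SLTilde.HasMeanCurvatureAt f N H p) :
    SLTilde.IsHolomorphicQuadraticDifferential
      {φ | SLTilde.IsConformalParameter f N φ} (SLTilde.abreschCoeff f N H) where
  transform _ hφ _ hψ _ hp := ⟨_, hφ.hasDerivAt_transition hψ hf.smooth hN hp,
    hφ.abreschCoeff_transition hψ hf.smooth hN H hp⟩
  holomorphic _ hφ := SLTilde.differentiableOn_abreschCoeff hφ hf.smooth hN hH
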